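/- Let $X$ be a finite poset with $d=|X|$ elements and let $G$ be a finite group acting on $X$ by poset automorphisms. Let $J(X)$ be the poset of lower order ideals of $X$ ordered by inclusion, and let $\Delta=\Delta(J(X))$ be its order complex, the simplicial complex of all chains of $J(X)$ (including the empty chain), with the induced $G$-action $J\mapsto gJ$ on vertices. Color each vertex $J$ of $\Delta$ by its rank $|J|\in\{0,\dots,d\}$; this coloring is $G$-invariant. For $S\subseteq\{0,\dots,d\}$ let $\Delta|_S$ be the subcomplex of those chains all of whose members have rank in $S$. A function $G\to\mathbb C$ is called effective if it is the character of a (possibly zero) finite-dimensional complex representation of $G$. Let $\mathfrak f_{i-1}$ be the character of the complex permutation representation of $G$ on the faces of $\Delta$ with $i$ elements, and $\mathfrak f_S$ the one on the faces of $\Delta$ whose set of ranks is exactly $S$. The equivariant $h$-vector and flag $h$-vector of $\Delta$ have the entries $$\mathfrak h_k=\sum_{i=0}^k(-1)^{k-i}\binom{d+1-i}{k-i}\mathfrak f_{i-1}\quad(0\le k\le d+1),\qquad \mathfrak h_S=\sum_{T\subseteq S}(-1)^{|S|-|T|}\mathfrak f_T\quad(S\subseteq\{0,\dots,d\}),$$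 and $\mathfrak h_k=0$ for $k>d+1$. The equivariant Hilbert series of the Stanley–Reisner ring $\mathbb C[\Delta]$ is $\operatorname{Hilb}_G(\mathbb C[\Delta],t)=\sum_{i\ge0}\chi_{\mathbb C[\Delta]_i}t^i$, where $\chi_{\mathbb C[\Delta]_i}$ is the character of $G$ on the homogeneous component of degree $i$. Let $G$ act on $\mathbb R^X$ by $gf=f\circ g^{-1}$, and let $$\mathscr O(X)=\{f\in\mathbb R^X\mid 0\le f(x)\le f(x')\le1\text{ for all }x\le x'\text{ in }X\}$$ be the order polytope of $X$. If $\mathscr O(X)$ is $G$-invariant, its equivariant Ehrhart series is $\operatorname{Ehr}_G(\mathscr O(X),t)=1+\sum_{m\ge1}\chi_mt^m$, where $\chi_m$ is the character of the complex permutation representation of $G$ on $m\mathscr O(X)\cap\mathbb Z^X$. **Theorem.** The order polytope $\mathscr O(X)$ is $G$-invariant, and the following hold. 1. $\operatorname{Ehr}_G(\mathscr O(X),t)=\operatorname{Hilb}_G(\mathbb C[\Delta],t)$. 2. $\displaystyle\operatorname{Ehr}_G(\mathscr O(X),t)=\frac1{(1-t)^{d+1}}\sum_{S\subseteq\{1,\dots,d-1\}}\mathfrak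 h_S\,t^{|S|}$. 3. For every $S\subseteq\{1,\dots,d-1\}$ the reduced homology $\widetilde H_i(\Delta|_S,\mathbb C)$ vanishes for all $i\ne|S|-1$, and $\mathfrak h_S$ is the character of the representation of $G$ on $\widetilde H_{|S|-1}(\Delta|_S,\mathbb C)$. 4. Every $\mathfrak h_k$ with $k\ge0$ and every $\mathfrak h_S$ with $S\subseteq\{0,\dots,d\}$ is effective. 5. For every $i\ge0$, $\displaystyle\mathfrak h_i=\sum_{S\subseteq\{0,\dots,d\},\,|S|=i}\mathfrak h_S=\sum_{S\subseteq\{1,\dots,d-1\},\,|S|=i}\mathfrak h_S$. -/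

import Mathlib

open scoped Pointwise

/-! ### Characters and permutation representations of a group -/

/-- A complex-valued function on `G` is *effective* if it is the character of a genuine
finite-dimensional complex representation of `G` (the zero representation is allowed). -/
def IsEffective {G : Type*} [Group G] (χ : G → ℂ) : Prop :=
  ∃ (n : ℕ) (τ : Representation ℂ G (Fin n → ℂ)), τ.character = χ

/-- The permutation representation over the field `𝕜` on the vector space with basis `Y`, for an action of `G` on `Y` given by a homomorphism to the symmetric group. -/
noncomputable def permRep (𝕜 : Type*) [Field 𝕜] {G Y : Type*} [Group G] (φ : G →* Equiv.Perm Y) :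
    Representation 𝕜 G (Y →₀ 𝕜) where
  toFun g := Finsupp.lmapDomain 𝕜 𝕜 (φ g)
  map_one' := by ext; simp
  map_mul' x y := by ext; simp

/-- The action of `G` on an invariant subset `A` of `Y`. -/
def restrictPerm {G Y : Type*} [Group G] (φ : G →* Equiv.Perm Y) (A : Set Y)
    (hA : ∀ g, ∀ y ∈ A, φ g y ∈ A) : G →* Equiv.Perm A where
  toFun g := (φ g).subtypePerm fun y =>
    ⟨fun h => by simpa using hA g⁻¹ _ h, hA g y⟩
  map_one' := by ext; simp
  map_mul' x y := by
    ext z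
    change φ (x * y) z = φ x (φ y z)
    rw [map_mul, Equiv.Perm.mul_apply]

/-- The character of the complex permutation representation of `G` on an invariant subset `A`
of `Y` (used for finite `A`). -/
noncomputable def permChar {G Y : Type*} [Group G] (φ : G →* Equiv.Perm Y) (A : Set Y)
    (hA : ∀ g, ∀ y ∈ A, φ g y ∈ A) : G → ℂ :=
  (permRep ℂ (restrictPerm φ A hA)).character

/-- The quotient `Z / (B ∩ Z)` for subspaces `B`, `Z` of a vector space `C`; this is `Z / B` when
`B` is contained in `Z`. -/
def SubQuotient {𝕜 C : Type*} [Field 𝕜] [AddCommGroup C] [Module 𝕜 C] (Z B : Submodule 𝕜 C) :=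
  Z ⧸ B.submoduleOf Z

instance {𝕜 C : Type*} [Field 𝕜] [AddCommGroup C] [Module 𝕜 C] (Z B : Submodule 𝕜 C) :
    AddCommGroup (SubQuotient Z B) :=
  inferInstanceAs (AddCommGroup (Z ⧸ B.submoduleOf Z))

instance {𝕜 C : Type*} [Field 𝕜] [AddCommGroup C] [Module 𝕜 C] (Z B : Submodule 𝕜 C) :
    Module 𝕜 (SubQuotient Z B) :=
  inferInstanceAs (Module 𝕜 (Z ⧸ B.submoduleOf Z))

/-- The representation induced on `Z / B` by a representation on `C` that leaves `Z` and `B`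
invariant. -/
def subQuotientRep {𝕜 C G : Type*} [Field 𝕜] [AddCommGroup C] [Module 𝕜 C] [Group G]
    (τ : Representation 𝕜 G C) (Z B : Submodule 𝕜 C) (hZ : ∀ g, Z ≤ Z.comap (τ g))
    (hB : ∀ g, B ≤ B.comap (τ g)) : Representation 𝕜 G (SubQuotient Z B) :=
  (τ.subrepresentation Z hZ).quotient (B.submoduleOf Z) fun g _ hx => hB g hx

/-! ### Simplicial complexes with a group action -/

/-- An abstract simplicial complex on `V`: a family of finite subsets of `V` closed under
taking subsets (the empty set is allowed as a face). -/
abbrev FaceComplex (V : Type*) := LowerSet (Finset V)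

/-- The action on finite subsets of `V` induced by an action on `V`. -/
def finsetPerm {G V : Type*} [Group G] (φ : G →* Equiv.Perm V) :
    G →* Equiv.Perm (Finset V) where
  toFun g := (φ g).finsetCongr
  map_one' := by
    ext σ : 1
    rw [map_one]
    exact Finset.map_refl
  map_mul' x y := by
    ext σ : 1
    rw [map_mul]
    exact (Finset.map_map (φ y).toEmbedding (φ x).toEmbedding σ).symm

/-- An action of `G` on a simplicial complex: an action on `V` that maps faces to faces. -/
structure ComplexAction (G : Type*) [Group G] {V : Type*} (K : FaceComplex V) where
  toPerm : G →* Equiv.Perm V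
  map_mem : ∀ g, ∀ σ ∈ K, finsetPerm toPerm g σ ∈ K

/-- A proper coloring: distinct vertices of a face have distinct colors. -/
structure ProperColoring {V : Type*} (K : FaceComplex V) (Γ : Type*) where
  color : V → Γ
  injOn : ∀ σ ∈ K, Set.InjOn color (σ : Set V)

/-- The action `A` preserves the coloring `γ`. -/
def ComplexAction.Preserves {G V Γ : Type*} [Group G] {K : FaceComplex V}
    (A : ComplexAction G K) (γ : ProperColoring K Γ) : Prop :=
  ∀ g v, γ.color (A.toPerm g v) = γ.color v

/-! ### The Stanley--Reisner ring and its equivariant Hilbert series -/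

section StanleyReisner

variable (𝕜 : Type*) [Field 𝕜] {V : Type*} (K : FaceComplex V)

/-- The Stanley--Reisner ideal, generated by the squarefree monomials of all non-faces. -/
noncomputable def srIdeal : Ideal (MvPolynomial V 𝕜) :=
  Ideal.span {m | ∃ σ : Finset V, σ ∉ K ∧ m = ∏ v ∈ σ, MvPolynomial.X v}

/-- The Stanley--Reisner ring `𝕜[K]`. -/
abbrev SRRing := MvPolynomial V 𝕜 ⧸ srIdeal 𝕜 K

/-- The homogeneous component of degree `i` of `𝕜[K]`: the classes of the homogeneous polynomials
of degree `i`. -/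
noncomputable def srComponent (i : ℕ) : Submodule 𝕜 (SRRing 𝕜 K) :=
  (MvPolynomial.homogeneousSubmodule V 𝕜 i).map
    (Ideal.Quotient.mkₐ 𝕜 (srIdeal 𝕜 K)).toLinearMap

variable {K} {G : Type*} [Group G] (A : ComplexAction G K)

theorem srIdeal_le_comap (g : G) :
    srIdeal 𝕜 K ≤ (srIdeal 𝕜 K).comap (MvPolynomial.rename (R := 𝕜) (A.toPerm g)) := by
  refine Ideal.span_le.2 ?_
  rintro _ ⟨σ, hσ, rfl⟩
  refine Ideal.subset_span ⟨finsetPerm A.toPerm g σ, fun h => hσ ?_, ?_⟩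
  · have := A.map_mem g⁻¹ _ h
    rwa [← Equiv.Perm.mul_apply, ← map_mul, inv_mul_cancel, map_one] at this
  · simp [finsetPerm, map_prod]

/-- The automorphism of `𝕜[K]` with `x_v ↦ x_{gv}`. -/
noncomputable def srAlgHom (g : G) : SRRing 𝕜 K →ₐ[𝕜] SRRing 𝕜 K :=
  Ideal.quotientMapₐ (srIdeal 𝕜 K) (MvPolynomial.rename (A.toPerm g)) (srIdeal_le_comap 𝕜 A g)

/-- The representation of `G` on `𝕜[K]`. -/
noncomputable def srRep : Representation 𝕜 G (SRRing 𝕜 K) where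
  toFun g := (srAlgHom 𝕜 A g).toLinearMap
  map_one' := by
    refine LinearMap.ext fun x => ?_
    obtain ⟨p, rfl⟩ := Ideal.Quotient.mk_surjective x
    change Ideal.Quotient.mk _ (MvPolynomial.rename (A.toPerm 1) p) = Ideal.Quotient.mk _ p
    rw [map_one, Equiv.Perm.coe_one, MvPolynomial.rename_id_apply]
  map_mul' g h := by
    refine LinearMap.ext fun x => ?_
    obtain ⟨p, rfl⟩ := Ideal.Quotient.mk_surjective x
    change Ideal.Quotient.mk _ (MvPolynomial.rename (A.toPerm (g * h)) p) =
      Ideal.Quotient.mk _ (MvPolynomial.rename (A.toPerm g) (MvPolynomial.rename (A.toPerm h) p))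
    rw [map_mul, Equiv.Perm.coe_mul, MvPolynomial.rename_rename]

theorem srComponent_le_comap (i : ℕ) (g : G) :
    srComponent 𝕜 K i ≤ (srComponent 𝕜 K i).comap (srRep 𝕜 A g) := by
  rintro _ ⟨p, hp, rfl⟩
  exact ⟨MvPolynomial.rename (A.toPerm g) p,
    MvPolynomial.IsHomogeneous.rename_isHomogeneous hp, rfl⟩

/-- The equivariant Hilbert series `∑ᵢ χ_{𝕜[K]ᵢ} tⁱ`, a power series whose coefficients are
functions on `G`. -/
noncomputable def eqHilb : PowerSeries (G → 𝕜) :=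
  PowerSeries.mk fun i =>
    ((srRep 𝕜 A).subrepresentation (srComponent 𝕜 K i) (srComponent_le_comap 𝕜 A i)).character

end StanleyReisner

/-! ### Equivariant `h`-vector and flag `h`-vector -/

section HVectors

variable {V : Type*} {K : FaceComplex V} {G : Type*} [Group G] (A : ComplexAction G K)

theorem card_finsetPerm (φ : G →* Equiv.Perm V) (g : G) (σ : Finset V) :
    (finsetPerm φ g σ).card = σ.card := by
  simp [finsetPerm]

/-- `fChar A i` is the character of the permutation representation on the faces with `i`
elements, that is, on the faces of dimension `i - 1`. -/
noncomputable def fChar (i : ℕ) : G → ℂ :=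
  permChar (finsetPerm A.toPerm) {σ | σ ∈ K ∧ σ.card = i}
    fun g σ hσ => ⟨A.map_mem g σ hσ.1, (card_finsetPerm A.toPerm g σ).trans hσ.2⟩

/-- The maximal cardinality of a face, that is, `dim K + 1` (for finite `V`). -/
noncomputable def maxFaceCard (K : FaceComplex V) : ℕ :=
  sSup {n | ∃ σ ∈ K, σ.card = n}

/-- The `k`-th entry of the equivariant `h`-vector; it vanishes for `k > dim K + 1`. -/
noncomputable def hChar (k : ℕ) : G → ℂ :=
  ∑ i ∈ Finset.range (k + 1),
    (-1) ^ (k - i) * ((maxFaceCard K - i).choose (k - i) : G → ℂ) * fChar A i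

variable {Γ : Type*} (γ : ProperColoring K Γ)

theorem color_finsetPerm (hγ : A.Preserves γ) (g : G) (σ : Finset V) :
    γ.color '' (finsetPerm A.toPerm g σ : Set V) = γ.color '' (σ : Set V) := by
  simp only [finsetPerm, MonoidHom.coe_mk, OneHom.coe_mk, Equiv.finsetCongr_apply,
    Finset.coe_map, Set.image_image]
  exact Set.image_congr fun v _ => hγ g v

variable (hγ : A.Preserves γ)

/-- The character of the permutation representation on the faces whose set of colors is `S`. -/
noncomputable def flagFChar (S : Finset Γ) : G → ℂ :=
  permChar (finsetPerm A.toPerm) {σ | σ ∈ K ∧ γ.color '' (σ : Set V) = S}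
    fun g σ hσ => ⟨A.map_mem g σ hσ.1, (color_finsetPerm A γ hγ g σ).trans hσ.2⟩

/-- The entry at `S` of the equivariant flag `h`-vector. -/
noncomputable def flagHChar (S : Finset Γ) : G → ℂ :=
  ∑ T ∈ S.powerset, (-1) ^ (S.card - T.card) * flagFChar A γ hγ T

/-- The color-selected subcomplex `K|_S` of the faces all of whose colors lie in `S`. -/
def colorSelect (S : Finset Γ) : FaceComplex V where
  carrier := {σ | σ ∈ K ∧ ∀ v ∈ σ, γ.color v ∈ S}
  lower' _ _ hτ hσ := ⟨K.lower hτ hσ.1, fun v hv => hσ.2 v (hτ hv)⟩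

/-- The coloring of `K|_S` inherited from `K`. -/
def ProperColoring.select (S : Finset Γ) : ProperColoring (colorSelect γ S) Γ where
  color := γ.color
  injOn σ hσ := γ.injOn σ hσ.1

/-- The action on `K|_S` inherited from a color-preserving action on `K`. -/
def ComplexAction.select (S : Finset Γ) : ComplexAction G (colorSelect γ S) where
  toPerm := A.toPerm
  map_mem g σ hσ := by
    refine ⟨A.map_mem g σ hσ.1, fun v hv => ?_⟩
    obtain ⟨w, hw, rfl⟩ := Finset.mem_map.1 hv
    simpa [hγ g w] using hσ.2 w hw

end HVectors

/-! ### Reduced simplicial homology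

The simplices are oriented by listing their vertices in the order of their colors. A
color-preserving action then permutes the oriented simplices. -/

section Homology

variable (𝕜 : Type*) [Field 𝕜] {V Γ : Type*} [LinearOrder Γ] {K : FaceComplex V} (γ : ProperColoring K Γ)

open scoped Classical in
/-- The (augmented) boundary map: `e_σ ↦ ∑ⱼ (-1)ʲ e_{σ ∖ vⱼ}` for `σ = {v₀ ≺ v₁ ≺ ⋯}`; the
position of `v` in `σ` is the number of vertices of `σ` of smaller color. -/
noncomputable def boundary : (Finset V →₀ 𝕜) →ₗ[𝕜] (Finset V →₀ 𝕜) :=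
  Finsupp.linearCombination 𝕜 fun σ : Finset V =>
    ∑ v ∈ σ, Finsupp.single (σ.erase v)
      ((-1 : 𝕜) ^ (σ.filter fun u => γ.color u < γ.color v).card)

/-- The chains spanned by the faces with `n` elements: chains of degree `n - 1`. -/
def chainSpace (K : FaceComplex V) (n : ℕ) : Submodule 𝕜 (Finset V →₀ 𝕜) :=
  Finsupp.supported 𝕜 𝕜 {σ | σ ∈ K ∧ σ.card = n}

/-- The reduced cycles of degree `n - 1`. -/
noncomputable def cycleSpace (n : ℕ) : Submodule 𝕜 (Finset V →₀ 𝕜) :=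
  chainSpace 𝕜 K n ⊓ LinearMap.ker (boundary 𝕜 γ)

/-- The boundaries of degree `n - 1`. -/
noncomputable def boundarySpace (n : ℕ) : Submodule 𝕜 (Finset V →₀ 𝕜) :=
  (chainSpace 𝕜 K (n + 1)).map (boundary 𝕜 γ)

/-- The reduced simplicial homology of `K` **in degree `n - 1`**, with coefficients in the
field `𝕜`: cycles modulo boundaries. -/
abbrev ReducedHomology (n : ℕ) :=
  SubQuotient (cycleSpace 𝕜 γ n) (boundarySpace 𝕜 γ n)

variable {G : Type*} [Group G] (A : ComplexAction G K)

theorem chainSpace_le_comap (n : ℕ) (g : G) :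
    chainSpace 𝕜 K n ≤ (chainSpace 𝕜 K n).comap (permRep 𝕜 (finsetPerm A.toPerm) g) := by
  classical
  intro x hx
  rw [Submodule.mem_comap, chainSpace, Finsupp.mem_supported]
  intro τ hτ
  obtain ⟨σ, hσ, rfl⟩ := Finset.mem_image.1 (Finsupp.mapDomain_support hτ)
  have h := (Finsupp.mem_supported 𝕜 x).1 hx hσ
  exact ⟨A.map_mem g σ h.1, (card_finsetPerm A.toPerm g σ).trans h.2⟩

theorem boundary_permRep (hγ : A.Preserves γ) (g : G) (x : Finset V →₀ 𝕜) :
    boundary 𝕜 γ (permRep 𝕜 (finsetPerm A.toPerm) g x) =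
      permRep 𝕜 (finsetPerm A.toPerm) g (boundary 𝕜 γ x) := by
  classical
  induction x using Finsupp.induction_linear with
  | zero => simp
  | add x y hx hy => simp [hx, hy]
  | single σ c =>
    simp only [permRep, MonoidHom.coe_mk, OneHom.coe_mk, Finsupp.lmapDomain_apply,
      Finsupp.mapDomain_single, boundary, Finsupp.linearCombination_single, map_smul,
      Finsupp.mapDomain_finsetSum]
    congr 1
    simp only [finsetPerm, MonoidHom.coe_mk, OneHom.coe_mk, Equiv.finsetCongr_apply,
      Finset.sum_map, Finset.map_erase, Finset.filter_map, Finset.card_map]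
    refine Finset.sum_congr rfl fun v _ => ?_
    congr 3
    refine Finset.filter_congr fun u _ => ?_
    simp [hγ g u, hγ g v]

theorem cycleSpace_le_comap (hγ : A.Preserves γ) (n : ℕ) (g : G) :
    cycleSpace 𝕜 γ n ≤ (cycleSpace 𝕜 γ n).comap (permRep 𝕜 (finsetPerm A.toPerm) g) := by
  rintro x ⟨hx, hx'⟩
  refine ⟨chainSpace_le_comap 𝕜 A n g hx, ?_⟩
  have hx'' : boundary 𝕜 γ x = 0 := hx'
  change boundary 𝕜 γ _ = 0
  rw [boundary_permRep 𝕜 γ A hγ, hx'', map_zero]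

theorem boundarySpace_le_comap (hγ : A.Preserves γ) (n : ℕ) (g : G) :
    boundarySpace 𝕜 γ n ≤ (boundarySpace 𝕜 γ n).comap (permRep 𝕜 (finsetPerm A.toPerm) g) := by
  rintro _ ⟨y, hy, rfl⟩
  exact ⟨permRep 𝕜 (finsetPerm A.toPerm) g y, chainSpace_le_comap 𝕜 A (n + 1) g hy,
    boundary_permRep 𝕜 γ A hγ g y⟩

/-- The representation of `G` on the reduced homology of `K` in degree `n - 1`. -/
noncomputable def homologyRep (hγ : A.Preserves γ) (n : ℕ) :
    Representation 𝕜 G (ReducedHomology 𝕜 γ n) :=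
  subQuotientRep (permRep 𝕜 (finsetPerm A.toPerm)) (cycleSpace 𝕜 γ n) (boundarySpace 𝕜 γ n)
    (cycleSpace_le_comap 𝕜 γ A hγ n) (boundarySpace_le_comap 𝕜 γ A hγ n)

end Homology

/-! ### Equivariant Ehrhart series -/

section Ehrhart

variable {G E : Type*} [Group G] [AddCommGroup E] [Module ℝ E] (ρ : G →* (E ≃ₗ[ℝ] E))

/-- The permutations of the points of `E` given by a linear action. -/
def pointPerm : G →* Equiv.Perm E where
  toFun g := (ρ g).toEquiv
  map_one' := by ext; simp
  map_mul' g h := by ext; simp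

theorem latticePoints_invariant (M : AddSubgroup E) (hM : ∀ g, ∀ v ∈ M, ρ g v ∈ M)
    (P : Set E) (hP : ∀ g, ρ g '' P = P) (m : ℕ) (g : G) (v : E) (hv : v ∈ ((m : ℝ) • P) ∩ (M : Set E)) :
    pointPerm ρ g v ∈ ((m : ℝ) • P) ∩ (M : Set E) := by
  obtain ⟨⟨p, hp, rfl⟩, hv⟩ := hv
  refine ⟨⟨ρ g p, ?_, ?_⟩, hM g _ hv⟩
  · rw [← hP g]
    exact ⟨p, hp, rfl⟩
  · simp [pointPerm]

/-- The equivariant Ehrhart series `1 + ∑_{m ≥ 1} χ_{mP} t^m` of a `G`-invariant lattice polytope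
`P` with respect to the `G`-invariant lattice `M`, for a linear action `ρ` of `G`; here `χ_{mP}` is
the character of the permutation representation on `mP ∩ M`. -/
noncomputable def eqEhr (M : AddSubgroup E) (hM : ∀ g, ∀ v ∈ M, ρ g v ∈ M)
    (P : Set E) (hP : ∀ g, ρ g '' P = P) : PowerSeries (G → ℂ) :=
  PowerSeries.mk fun m =>
    if m = 0 then 1
    else permChar (pointPerm ρ) (((m : ℝ) • P) ∩ (M : Set E))
      (latticePoints_invariant ρ M hM P hP m)

end Ehrhart

/-! ### Order polytopes and order complexes -/

section OrderPolytope

/-- The order polytope of `X`. -/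
def orderPolytope (X : Type*) [PartialOrder X] : Set (X → ℝ) :=
  {f | ∀ x x', x ≤ x' → 0 ≤ f x ∧ f x ≤ f x' ∧ f x' ≤ 1}

/-- The lattice `ℤ^X` in `ℝ^X`. -/
def intLattice (X : Type*) : AddSubgroup (X → ℝ) where
  carrier := {f | ∀ x, ∃ n : ℤ, f x = n}
  zero_mem' x := ⟨0, by simp⟩
  add_mem' {f f'} hf hf' x := by
    obtain ⟨n, hn⟩ := hf x
    obtain ⟨n', hn'⟩ := hf' x
    exact ⟨n + n', by simp [hn, hn']⟩
  neg_mem' {f} hf x := by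
    obtain ⟨n, hn⟩ := hf x
    exact ⟨-n, by simp [hn]⟩

/-- The order complex of a poset: the complex of its finite chains. -/
def orderComplex (Q : Type*) [PartialOrder Q] : FaceComplex Q where
  carrier := {σ | IsChain (· ≤ ·) (σ : Set Q)}
  lower' _ _ hτ hσ := IsChain.mono (Finset.coe_subset.2 hτ) hσ

variable {X G : Type*} [PartialOrder X] [Group G] (a : G →* (X ≃o X))

/-- The permutation representation on `ℝ^X`: `g` maps `f` to `f ∘ g⁻¹`. -/
def coordRep : G →* ((X → ℝ) ≃ₗ[ℝ] (X → ℝ)) where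
  toFun g := LinearEquiv.funCongrLeft ℝ ℝ (a g⁻¹).toEquiv
  map_one' := by ext; simp
  map_mul' g h := by ext; simp

theorem coordRep_intLattice (g : G) (f : X → ℝ) (hf : f ∈ intLattice X) :
    coordRep a g f ∈ intLattice X :=
  fun x => hf (a g⁻¹ x)

/-- The action on the order complex of `J(X)`, the poset of lower order ideals of `X` ordered by
inclusion: `g` maps an order ideal `J` to its image `gJ`. -/
def idealAction : ComplexAction G (orderComplex (LowerSet X)) where
  toPerm :=
    { toFun := fun g => (LowerSet.map (a g)).toEquiv
      map_one' := by ext; simp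
      map_mul' := fun g h => by ext; simp }
  map_mem g σ hσ := by
    intro I' hI' J' hJ' _
    obtain ⟨I, hI, rfl⟩ := Finset.mem_map.1 (Finset.mem_coe.1 hI')
    obtain ⟨J, hJ, rfl⟩ := Finset.mem_map.1 (Finset.mem_coe.1 hJ')
    exact (hσ.total hI hJ).imp (fun h => (LowerSet.map (a g)).monotone h)
      (fun h => (LowerSet.map (a g)).monotone h)

/-- The standard coloring of the order complex of `J(X)`: the color of an order ideal is its rank,
that is, its cardinality. -/
noncomputable def rankColoring (X : Type*) [PartialOrder X] [Finite X] :
    ProperColoring (orderComplex (LowerSet X)) ℕ where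
  color J := (J : Set X).ncard
  injOn σ hσ I hI J hJ h := by
    rcases hσ.total hI hJ with hIJ | hJI
    · exact SetLike.coe_injective (Set.eq_of_subset_of_ncard_le hIJ h.ge (Set.toFinite _))
    · exact SetLike.coe_injective (Set.eq_of_subset_of_ncard_le hJI h.le (Set.toFinite _)).symm

theorem idealAction_preserves [Finite X] : (idealAction a).Preserves (rankColoring X) := by
  intro g J
  exact Set.ncard_image_of_injective (J : Set X) (a g).injective

end OrderPolytope

/-!
A multiset of order ideals is sent to its height function `X → ℕ`, which counts the members not
containing a given point. On multisets of size `m` whose members form a chain this is an equivariant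
bijection onto the lattice points of `m 𝒪(X)`, and these multisets index the monomial basis of
`ℂ[Δ]` in degree `m`; hence the Ehrhart and Hilbert series agree. A face fixed by `g` is fixed
vertexwise, because its vertices have distinct ranks, so the Hilbert series is the sum of
`𝔣_T (t / (1 - t)) ^ |T|` over sets `T` of ranks, and inclusion–exclusion turns it into
`∑ 𝔥_S t ^ |S| / (1 - t) ^ (d + 1)`. Since `∅` and `X` are cone points of `Δ`, every `𝔥_S` with
`0 ∈ S` or `d ∈ S` vanishes.

For `S ⊆ {1, …, d - 1}` fix a linear extension `ω` of `X`. A chain of order ideals determines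
another linear extension, by sorting within each step of the chain according to `ω`; let its class
be the set of inversions of that extension relative to `ω`. If the chain has no member of rank
`s ∈ S`, then the initial segment of size `s` of its linear extension can be added to and removed
from all chains of the same class. This gives a chain homotopy that decreases classes and kills all
reduced homology of `Δ|_S` below the top degree. By the Hopf trace formula `𝔥_S` is then the
character on the top homology, and in particular effective.
-/

/-! ### Characters -/

section Characters

variable {𝕜 G : Type*} [Field 𝕜] [Group G]

theorem trace_eq_add_of_exact {U V W : Type*} [AddCommGroup U] [Module 𝕜 U] [AddCommGroup V]
    [Module 𝕜 V] [AddCommGroup W] [Module 𝕜 W] [FiniteDimensional 𝕜 V] {i : U →ₗ[𝕜] V}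
    {p : V →ₗ[𝕜] W} (hi : Function.Injective i) (hp : Function.Surjective p)
    (hip : Function.Exact i p) {TU : Module.End 𝕜 U} {T : Module.End 𝕜 V} {TW : Module.End 𝕜 W}
    (hU : T ∘ₗ i = i ∘ₗ TU) (hW : p ∘ₗ T = TW ∘ₗ p) :
    LinearMap.trace 𝕜 V T = LinearMap.trace 𝕜 U TU + LinearMap.trace 𝕜 W TW := by
  have : FiniteDimensional 𝕜 U := FiniteDimensional.of_injective i hi
  have : FiniteDimensional 𝕜 W := Module.Finite.of_surjective p hp
  obtain ⟨s, hs⟩ := p.exists_rightInverse_of_surjective (LinearMap.range_eq_top.2 hp)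
  have hps (x : W) : p (s x) = x := LinearMap.congr_fun hs x
  let q : V →ₗ[𝕜] U := (LinearMap.id - s ∘ₗ p).codRestrictOfInjective i hi fun v =>
    (hip _).1 (by simp [hps])
  have hiq (v : V) : i (q v) = v - s (p v) := LinearMap.codRestrictOfInjective_comp_apply ..
  have hqT : q ∘ₗ (T ∘ₗ i) = TU := LinearMap.ext fun x => hi <| by
    rw [hU, LinearMap.comp_apply, LinearMap.comp_apply, hiq, hip.apply_apply_eq_zero, map_zero,
      sub_zero]
  have hpT : p ∘ₗ (T ∘ₗ s) = TW := by
    rw [← LinearMap.comp_assoc, hW, LinearMap.comp_assoc, hs, LinearMap.comp_id]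
  have hsplit : T = (T ∘ₗ i) ∘ₗ q + (T ∘ₗ s) ∘ₗ p := LinearMap.ext fun v => by
    simp only [LinearMap.add_apply, LinearMap.comp_apply, hiq, map_sub, sub_add_cancel]
  rw [hsplit, map_add, LinearMap.trace_comp_comm' q, LinearMap.trace_comp_comm' p, hqT, hpT]

theorem permRep_single {Y : Type*} (φ : G →* Equiv.Perm Y) (g : G) (y : Y) (c : 𝕜) :
    permRep 𝕜 φ g (Finsupp.single y c) = Finsupp.single (φ g y) c :=
  Finsupp.mapDomain_single

theorem permRep_character {Y : Type*} [Finite Y] (φ : G →* Equiv.Perm Y) (g : G) :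
    (permRep 𝕜 φ).character g = ({y | φ g y = y} : Set Y).ncard := by
  classical
  cases nonempty_fintype Y
  rw [Representation.character, LinearMap.trace_eq_matrix_trace 𝕜 Finsupp.basisSingleOne,
    Matrix.trace, Set.ncard_eq_toFinset_card', Finset.card_eq_sum_ones, Nat.cast_sum,
    Set.toFinset_ofPred, Finset.sum_filter]
  refine Finset.sum_congr rfl fun y _ => ?_
  simp [LinearMap.toMatrix_apply, permRep_single, Finsupp.single_apply]

theorem permChar_apply {Y : Type*} (φ : G →* Equiv.Perm Y) {A : Set Y}
    (hA : ∀ g, ∀ y ∈ A, φ g y ∈ A) (hfin : A.Finite) (g : G) :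
    permChar φ A hA g = ({y | y ∈ A ∧ φ g y = y} : Set Y).ncard := by
  have := hfin.to_subtype
  rw [permChar, permRep_character, ← Set.ncard_image_of_injective _ Subtype.val_injective]
  congr 2
  ext y
  constructor
  · rintro ⟨z, hz, rfl⟩
    exact ⟨z.2, congrArg Subtype.val hz⟩
  · rintro ⟨hy, h⟩
    exact ⟨⟨y, hy⟩, Subtype.ext h, rfl⟩

theorem permChar_congr {Y Y' : Type*} {φ : G →* Equiv.Perm Y} {ψ : G →* Equiv.Perm Y'}
    {A : Set Y} {B : Set Y'} {hA : ∀ g, ∀ y ∈ A, φ g y ∈ A} {hB : ∀ g, ∀ y ∈ B, ψ g y ∈ B}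
    {f : Y → Y'} (hf : Set.BijOn f A B) (h : ∀ g, ∀ y ∈ A, f (φ g y) = ψ g (f y)) :
    permChar φ A hA = permChar ψ B hB := by
  refine Representation.char_iso (.mk (Finsupp.domLCongr (hf.equiv f)) fun g =>
    Finsupp.lhom_ext fun y c => ?_)
  simp only [LinearMap.comp_apply, LinearEquiv.coe_coe, permRep_single, Finsupp.domLCongr_single]
  congr 1
  exact Subtype.ext (h g y y.2)

theorem character_supported {Y : Type*} (φ : G →* Equiv.Perm Y) {A : Set Y}
    (hA : ∀ g, ∀ y ∈ A, φ g y ∈ A)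
    (h : ∀ g, Finsupp.supported ℂ ℂ A ≤ (Finsupp.supported ℂ ℂ A).comap (permRep ℂ φ g)) :
    ((permRep ℂ φ).subrepresentation (Finsupp.supported ℂ ℂ A) h).character =
      permChar φ A hA := by
  refine (Representation.char_iso (.mk (Finsupp.supportedEquivFinsupp A).symm fun g =>
    Finsupp.lhom_ext fun y c => Subtype.ext ?_)).symm
  have he (z : A) : (((Finsupp.supportedEquivFinsupp A).symm (Finsupp.single z c) :
      Finsupp.supported ℂ ℂ A) : Y →₀ ℂ) = Finsupp.single (z : Y) c := by
    rw [Finsupp.supportedEquivFinsupp_symm_single]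
  rw [LinearMap.comp_apply, permRep_single]
  exact (he _).trans (((permRep_single φ g (y : Y) c).symm).trans
    (congrArg (permRep ℂ φ g) (he y).symm))

theorem isEffective_of_representation {V : Type*} [AddCommGroup V] [Module ℂ V]
    [FiniteDimensional ℂ V] (τ : Representation ℂ G V) : IsEffective τ.character := by
  let e := (Module.finBasis ℂ V).equivFun
  let τ' : Representation ℂ G (Fin (Module.finrank ℂ V) → ℂ) :=
    (e.conjAlgEquiv ℂ : _ →* _).comp τ
  exact ⟨_, τ', funext fun g => LinearMap.trace_conj' (τ g) e⟩

theorem isEffective_zero : IsEffective (0 : G → ℂ) :=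
  ⟨0, 1, funext fun _ => by simp [Representation.character]⟩

theorem IsEffective.add {χ ψ : G → ℂ} (hχ : IsEffective χ) (hψ : IsEffective ψ) :
    IsEffective (χ + ψ) := by
  obtain ⟨n, τ, rfl⟩ := hχ
  obtain ⟨m, υ, rfl⟩ := hψ
  convert isEffective_of_representation (τ.prod υ) using 1
  exact funext fun g => (LinearMap.trace_prodMap' (τ g) (υ g)).symm

theorem isEffective_sum {ι : Type*} {s : Finset ι} {χ : ι → G → ℂ}
    (h : ∀ i ∈ s, IsEffective (χ i)) : IsEffective (∑ i ∈ s, χ i) :=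
  Finset.sum_induction χ IsEffective (fun _ _ => IsEffective.add) isEffective_zero h

end Characters

/-! ### The simplicial chain complex -/

section BoundaryMap

open scoped Classical in
/-- The sign of the facet `σ ∖ v` in the boundary of `σ`. -/
noncomputable def faceSign (𝕜 : Type*) [Field 𝕜] {V Γ : Type*} [LinearOrder Γ]
    {K : FaceComplex V} (γ : ProperColoring K Γ) (σ : Finset V) (v : V) : 𝕜 :=
  (-1) ^ (σ.filter fun u => γ.color u < γ.color v).card

variable (𝕜 : Type*) [Field 𝕜] {V Γ : Type*} [LinearOrder Γ] {K : FaceComplex V}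
  (γ : ProperColoring K Γ)

theorem faceSign_mul_self (σ : Finset V) (v : V) :
    faceSign 𝕜 γ σ v * faceSign 𝕜 γ σ v = 1 :=
  pow_mul_pow_eq_one _ (by norm_num)

open scoped Classical in
theorem faceSign_erase_of_lt {σ : Finset V} {u v : V} (h : γ.color u < γ.color v) :
    faceSign 𝕜 γ (σ.erase v) u = faceSign 𝕜 γ σ u := by
  rw [faceSign, faceSign, Finset.filter_erase, Finset.erase_eq_of_notMem]
  simp [h.le]

open scoped Classical in
theorem faceSign_erase_of_gt {σ : Finset V} {u v : V} (hu : u ∈ σ) (h : γ.color u < γ.color v) :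
    faceSign 𝕜 γ (σ.erase u) v = -faceSign 𝕜 γ σ v := by
  have hmem : u ∈ σ.filter fun w => γ.color w < γ.color v := by simp [hu, h]
  rw [faceSign, faceSign, Finset.filter_erase, ← Finset.card_erase_add_one hmem, pow_succ,
    mul_neg_one, neg_neg]

open scoped Classical in
theorem faceSign_mul_faceSign_erase {σ : Finset V} (hσ : σ ∈ K) {u v : V} (hu : u ∈ σ)
    (hv : v ∈ σ) (huv : u ≠ v) :
    faceSign 𝕜 γ σ v * faceSign 𝕜 γ (σ.erase v) u =
      -(faceSign 𝕜 γ σ u * faceSign 𝕜 γ (σ.erase u) v) := by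
  have hc : γ.color u ≠ γ.color v := fun h => huv (γ.injOn σ hσ hu hv h)
  rcases hc.lt_or_gt with h | h
  · rw [faceSign_erase_of_lt 𝕜 γ h, faceSign_erase_of_gt 𝕜 γ hu h]
    ring
  · rw [faceSign_erase_of_lt 𝕜 γ h, faceSign_erase_of_gt 𝕜 γ hv h]
    ring

open scoped Classical in
theorem faceSign_mul_faceSign_add {σ : Finset V} (hσ : σ ∈ K) {u v : V} (hu : u ∈ σ)
    (hv : v ∈ σ) (huv : u ≠ v) :
    faceSign 𝕜 γ σ v * faceSign 𝕜 γ σ u +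
      faceSign 𝕜 γ (σ.erase v) u * faceSign 𝕜 γ (σ.erase u) v = 0 := by
  linear_combination
    faceSign 𝕜 γ (σ.erase v) u * faceSign 𝕜 γ σ u * faceSign_mul_faceSign_erase 𝕜 γ hσ hu hv huv -
      faceSign 𝕜 γ σ v * faceSign 𝕜 γ σ u * faceSign_mul_self 𝕜 γ (σ.erase v) u -
      faceSign 𝕜 γ (σ.erase v) u * faceSign 𝕜 γ (σ.erase u) v * faceSign_mul_self 𝕜 γ σ u

open scoped Classical in
theorem boundary_single (σ : Finset V) (c : 𝕜) :
    boundary 𝕜 γ (Finsupp.single σ c) =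
      ∑ v ∈ σ, Finsupp.single (σ.erase v) (c * faceSign 𝕜 γ σ v) := by
  simp [boundary, Finsupp.linearCombination_single, Finset.smul_sum, faceSign]

theorem boundary_boundary_single {σ : Finset V} (hσ : σ ∈ K) (c : 𝕜) :
    boundary 𝕜 γ (boundary 𝕜 γ (Finsupp.single σ c)) = 0 := by
  classical
  simp only [boundary_single, map_sum]
  rw [Finset.sum_sigma']
  refine Finset.sum_involution (fun p _ => ⟨p.2, p.1⟩) ?_ ?_ ?_ fun _ _ => rfl
  · rintro ⟨v, u⟩ hp
    obtain ⟨hv, huv, hu⟩ : v ∈ σ ∧ u ≠ v ∧ u ∈ σ := by simpa using hp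
    dsimp only
    rw [Finset.erase_right_comm, ← Finsupp.single_add, mul_assoc, mul_assoc,
      faceSign_mul_faceSign_erase 𝕜 γ hσ hu hv huv, ← mul_add, neg_add_cancel, mul_zero,
      Finsupp.single_zero]
  · rintro ⟨v, u⟩ hp _ h
    obtain ⟨-, huv, -⟩ : v ∈ σ ∧ u ≠ v ∧ u ∈ σ := by simpa using hp
    exact huv (congrArg Sigma.fst h)
  · rintro ⟨v, u⟩ hp
    obtain ⟨hv, huv, hu⟩ : v ∈ σ ∧ u ≠ v ∧ u ∈ σ := by simpa using hp
    simp [hv, hu, huv.symm]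

theorem single_mem_chainSpace {n : ℕ} {σ : Finset V} (hσ : σ ∈ K) (hn : σ.card = n) (c : 𝕜) :
    Finsupp.single σ c ∈ chainSpace 𝕜 K n :=
  Finsupp.single_mem_supported 𝕜 c ⟨hσ, hn⟩

theorem chainSpace_eq_span (K : FaceComplex V) (n : ℕ) :
    chainSpace 𝕜 K n =
      Submodule.span 𝕜 ((fun σ => Finsupp.single σ 1) '' {σ | σ ∈ K ∧ σ.card = n}) :=
  Finsupp.supported_eq_span_single 𝕜 _

theorem boundary_boundary {n : ℕ} {x : Finset V →₀ 𝕜} (hx : x ∈ chainSpace 𝕜 K n) :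
    boundary 𝕜 γ (boundary 𝕜 γ x) = 0 := by
  suffices chainSpace 𝕜 K n ≤ LinearMap.ker (boundary 𝕜 γ ∘ₗ boundary 𝕜 γ) from this hx
  rw [chainSpace_eq_span, Submodule.span_le, Set.image_subset_iff]
  exact fun σ hσ => boundary_boundary_single 𝕜 γ hσ.1 1

theorem boundary_mem_chainSpace {n : ℕ} {x : Finset V →₀ 𝕜} (hx : x ∈ chainSpace 𝕜 K (n + 1)) :
    boundary 𝕜 γ x ∈ chainSpace 𝕜 K n := by
  classical
  suffices chainSpace 𝕜 K (n + 1) ≤ (chainSpace 𝕜 K n).comap (boundary 𝕜 γ) from this hx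
  rw [chainSpace_eq_span, Submodule.span_le, Set.image_subset_iff]
  rintro σ ⟨hσ, hn⟩
  rw [Set.mem_preimage, SetLike.mem_coe, Submodule.mem_comap, boundary_single]
  refine Submodule.sum_mem _ fun v hv => ?_
  exact single_mem_chainSpace 𝕜 (K.lower (Finset.erase_subset v σ) hσ)
    (by rw [Finset.card_erase_of_mem hv, hn, Nat.add_sub_cancel]) _

theorem boundarySpace_le_cycleSpace (n : ℕ) : boundarySpace 𝕜 γ n ≤ cycleSpace 𝕜 γ n := by
  rintro _ ⟨x, hx, rfl⟩
  exact ⟨boundary_mem_chainSpace 𝕜 γ hx, boundary_boundary 𝕜 γ hx⟩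

theorem chainSpace_eq_bot {n : ℕ} (h : ∀ σ ∈ K, σ.card ≠ n) : chainSpace 𝕜 K n = ⊥ := by
  have hempty : {σ | σ ∈ K ∧ σ.card = n} = ∅ :=
    Set.eq_empty_of_forall_notMem fun σ hσ => h σ hσ.1 hσ.2
  rw [chainSpace, hempty, Finsupp.supported_empty]

theorem subsingleton_reducedHomology {n : ℕ} (h : cycleSpace 𝕜 γ n ≤ boundarySpace 𝕜 γ n) :
    Subsingleton (ReducedHomology 𝕜 γ n) :=
  Submodule.Quotient.subsingleton_iff.2 (Submodule.comap_subtype_eq_top.2 h)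

end BoundaryMap

/-! ### A vanishing criterion for reduced homology -/

section Toggle

variable (𝕜 : Type*) [Field 𝕜] {V Γ W : Type*} [LinearOrder Γ] {K : FaceComplex V}
  (γ : ProperColoring K Γ) {c : Finset V → Finset W}

open scoped Classical in
/-- The vertex `v` can be added to and removed from all faces of `K` in the class `c = D` without
leaving this class. -/
def IsToggle (K : FaceComplex V) (c : Finset V → Finset W) (D : Finset W) (v : V) : Prop :=
  ∀ σ ∈ K, c σ = D → insert v σ ∈ K ∧ c (insert v σ) = D ∧ c (σ.erase v) = D

open scoped Classical in
/-- The chain homotopy `h` that adds the vertex `v (c σ)` to the face `σ`, if this stays within the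
class of `σ`. If `v (c σ)` is a toggle, then `id - ∂h - h∂` maps `σ` to a combination of faces of
strictly smaller class. -/
noncomputable def toggleHomotopy (c : Finset V → Finset W) (v : Finset W → V) :
    (Finset V →₀ 𝕜) →ₗ[𝕜] (Finset V →₀ 𝕜) :=
  Finsupp.linearCombination 𝕜 fun σ =>
    if v (c σ) ∉ σ ∧ insert (v (c σ)) σ ∈ K ∧ c (insert (v (c σ)) σ) = c σ then
      Finsupp.single (insert (v (c σ)) σ) (faceSign 𝕜 γ (insert (v (c σ)) σ) (v (c σ)))
    else 0

variable {𝕜 γ} {v : Finset W → V} {σ : Finset V}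

open scoped Classical in
theorem toggleHomotopy_single_of_insert {D : Finset W} (hD : c σ = D) (hmem : v D ∉ σ)
    (hK : insert (v D) σ ∈ K) (hins : c (insert (v D) σ) = D) (a : 𝕜) :
    toggleHomotopy 𝕜 γ c v (Finsupp.single σ a) =
      Finsupp.single (insert (v D) σ) (a * faceSign 𝕜 γ (insert (v D) σ) (v D)) := by
  subst hD
  rw [toggleHomotopy, Finsupp.linearCombination_single, if_pos ⟨hmem, hK, hins⟩,
    Finsupp.smul_single, smul_eq_mul]

theorem toggleHomotopy_single_of_mem (h : v (c σ) ∈ σ) (a : 𝕜) :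
    toggleHomotopy 𝕜 γ c v (Finsupp.single σ a) = 0 := by
  rw [toggleHomotopy, Finsupp.linearCombination_single, if_neg fun h' => h'.1 h, smul_zero]

theorem toggleHomotopy_single_mem_supported (p : Finset W → Prop) (hσ : p (c σ)) (a : 𝕜) :
    toggleHomotopy 𝕜 γ c v (Finsupp.single σ a) ∈ Finsupp.supported 𝕜 𝕜 {τ | p (c τ)} := by
  rw [toggleHomotopy, Finsupp.linearCombination_single]
  refine Submodule.smul_mem _ _ ?_
  split_ifs with h
  · refine Finsupp.single_mem_supported 𝕜 _ ?_
    rwa [Set.mem_ofPred_eq, h.2.2]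
  · exact zero_mem _

theorem toggleHomotopy_mem_chainSpace {n : ℕ} {x : Finset V →₀ 𝕜} (hx : x ∈ chainSpace 𝕜 K n) :
    toggleHomotopy 𝕜 γ c v x ∈ chainSpace 𝕜 K (n + 1) := by
  classical
  suffices chainSpace 𝕜 K n ≤ (chainSpace 𝕜 K (n + 1)).comap (toggleHomotopy 𝕜 γ c v) from this hx
  rw [chainSpace_eq_span, Submodule.span_le, Set.image_subset_iff]
  rintro σ ⟨-, hn⟩
  simp only [Set.mem_preimage, SetLike.mem_coe, Submodule.mem_comap, toggleHomotopy,
    Finsupp.linearCombination_single, one_smul]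
  split_ifs with h
  · exact single_mem_chainSpace 𝕜 h.2.1 (by rw [Finset.card_insert_of_notMem h.1, hn]) _
  · exact zero_mem _

theorem single_sub_homotopy_mem_of_mem (hc : Monotone c) (hσ : σ ∈ K)
    (hv : IsToggle K c (c σ) (v (c σ))) (hmem : v (c σ) ∈ σ) :
    Finsupp.single σ 1 - boundary 𝕜 γ (toggleHomotopy 𝕜 γ c v (Finsupp.single σ 1)) -
      toggleHomotopy 𝕜 γ c v (boundary 𝕜 γ (Finsupp.single σ 1)) ∈
      Finsupp.supported 𝕜 𝕜 {τ | c τ ⊂ c σ} := by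
  classical
  have hins := Finset.insert_erase hmem
  have hself : toggleHomotopy 𝕜 γ c v
      (Finsupp.single (σ.erase (v (c σ))) (1 * faceSign 𝕜 γ σ (v (c σ)))) = Finsupp.single σ 1 := by
    rw [toggleHomotopy_single_of_insert (hv σ hσ rfl).2.2 (Finset.notMem_erase _ _)
      (hins.symm ▸ hσ) (congrArg c hins), hins, one_mul, faceSign_mul_self]
  rw [toggleHomotopy_single_of_mem hmem, map_zero, sub_zero, boundary_single, map_sum,
    ← Finset.add_sum_erase _ _ hmem, hself, sub_add_cancel_left]
  refine neg_mem (Submodule.sum_mem _ fun u hu => ?_)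
  have hvu : v (c σ) ≠ u := (Finset.ne_of_mem_erase hu).symm
  rcases (hc (Finset.erase_subset u σ)).eq_or_ssubset with hcu | hcu
  · rw [toggleHomotopy_single_of_mem (by rw [hcu]; exact Finset.mem_erase.2 ⟨hvu, hmem⟩)]
    exact zero_mem _
  · exact toggleHomotopy_single_mem_supported (· ⊂ c σ) hcu _

open scoped Classical in
theorem toggleHomotopy_single_erase (hc : Monotone c) (hσ : σ ∈ K)
    (hv : IsToggle K c (c σ) (v (c σ))) (hmem : v (c σ) ∉ σ) {u : V} (hu : u ∈ σ)
    (hcu : c (σ.erase u) = c σ) (a : 𝕜) :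
    toggleHomotopy 𝕜 γ c v (Finsupp.single (σ.erase u) a) =
      Finsupp.single ((insert (v (c σ)) σ).erase u)
        (a * faceSign 𝕜 γ ((insert (v (c σ)) σ).erase u) (v (c σ))) := by
  obtain ⟨hK, hcv, -⟩ := hv σ hσ rfl
  have hins : insert (v (c σ)) (σ.erase u) = (insert (v (c σ)) σ).erase u :=
    (Finset.erase_insert_of_ne (ne_of_mem_of_not_mem hu hmem).symm).symm
  have hle : c (insert (v (c σ)) (σ.erase u)) ≤ c σ :=
    (hc (Finset.insert_subset_insert _ (Finset.erase_subset u σ))).trans_eq hcv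
  have hge : c σ ≤ c (insert (v (c σ)) (σ.erase u)) :=
    hcu.symm.trans_le (hc (Finset.subset_insert _ _))
  rw [toggleHomotopy_single_of_insert hcu (fun h => hmem (Finset.mem_of_mem_erase h))
    (hins ▸ K.lower (Finset.erase_subset u _) hK) (hle.antisymm hge), hins]

theorem single_sub_homotopy_mem_of_notMem (hc : Monotone c) (hσ : σ ∈ K)
    (hv : IsToggle K c (c σ) (v (c σ))) (hmem : v (c σ) ∉ σ) :
    Finsupp.single σ 1 - boundary 𝕜 γ (toggleHomotopy 𝕜 γ c v (Finsupp.single σ 1)) -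
      toggleHomotopy 𝕜 γ c v (boundary 𝕜 γ (Finsupp.single σ 1)) ∈
      Finsupp.supported 𝕜 𝕜 {τ | c τ ⊂ c σ} := by
  classical
  obtain ⟨hK, hcv, -⟩ := hv σ hσ rfl
  rw [toggleHomotopy_single_of_insert rfl hmem hK hcv, boundary_single, boundary_single,
    Finset.sum_insert hmem, Finset.erase_insert hmem, map_sum, one_mul, faceSign_mul_self,
    sub_add_cancel_left, sub_eq_add_neg, ← neg_add, ← Finset.sum_add_distrib]
  refine neg_mem (Submodule.sum_mem _ fun u hu => ?_)
  rcases (hc (Finset.erase_subset u σ)).eq_or_ssubset with hcu | hcu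
  · have hsign := faceSign_mul_faceSign_add 𝕜 γ hK (Finset.mem_insert_of_mem hu)
      (Finset.mem_insert_self (v (c σ)) σ) (ne_of_mem_of_not_mem hu hmem)
    rw [Finset.erase_insert hmem] at hsign
    rw [toggleHomotopy_single_erase hc hσ hv hmem hu hcu, ← Finsupp.single_add, one_mul, hsign,
      Finsupp.single_zero]
    exact zero_mem _
  · refine add_mem (Finsupp.single_mem_supported 𝕜 _ ?_)
      (toggleHomotopy_single_mem_supported (· ⊂ c σ) hcu _)
    refine ((hc (Finset.erase_subset u _)).trans_eq hcv : _ ⊆ c σ).ssubset_of_ne fun h => hcu.ne ?_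
    have := (hv _ (K.lower (Finset.erase_subset u _) hK) h).2.2
    rwa [Finset.erase_right_comm, Finset.erase_insert hmem] at this

theorem sub_boundary_toggleHomotopy_mem (hc : Monotone c) {n m : ℕ}
    (hv : ∀ σ ∈ K, σ.card = n → IsToggle K c (c σ) (v (c σ))) {z : Finset V →₀ 𝕜}
    (hz : z ∈ cycleSpace 𝕜 γ n) (hzm : z ∈ Finsupp.supported 𝕜 𝕜 {σ | (c σ).card ≤ m}) :
    z - boundary 𝕜 γ (toggleHomotopy 𝕜 γ c v z) ∈
      Finsupp.supported 𝕜 𝕜 {σ | (c σ).card < m} := by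
  let h := toggleHomotopy 𝕜 γ c v
  let Φ : Module.End 𝕜 (Finset V →₀ 𝕜) := LinearMap.id - boundary 𝕜 γ ∘ₗ h - h ∘ₗ boundary 𝕜 γ
  have hΦz : Φ z = z - boundary 𝕜 γ (h z) := by
    simp only [Φ, LinearMap.sub_apply, LinearMap.comp_apply, LinearMap.mem_ker.1 hz.2, map_zero,
      sub_zero, LinearMap.id_apply]
  rw [← hΦz, ← Finsupp.sum_single z, map_finsuppSum]
  refine Submodule.finsuppSum_mem 𝕜 _ _ _ fun σ hσ => ?_
  obtain ⟨hσK, hσn⟩ := hz.1 (Finsupp.mem_support_iff.2 hσ)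
  have hlt : Finsupp.supported 𝕜 𝕜 {τ | c τ ⊂ c σ} ≤
      Finsupp.supported 𝕜 𝕜 {τ | (c τ).card < m} := Finsupp.supported_mono fun τ hτ =>
    (Finset.card_lt_card hτ).trans_le (hzm (Finsupp.mem_support_iff.2 hσ))
  rw [← mul_one (z σ), ← smul_eq_mul, ← Finsupp.smul_single, map_smul]
  refine Submodule.smul_mem _ _ (hlt ?_)
  by_cases hmem : v (c σ) ∈ σ
  · exact single_sub_homotopy_mem_of_mem hc hσK (hv σ hσK hσn) hmem
  · exact single_sub_homotopy_mem_of_notMem hc hσK (hv σ hσK hσn) hmem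

theorem cycleSpace_le_boundarySpace_of_forall_isToggle (hc : Monotone c) {n : ℕ}
    (hv : ∀ σ ∈ K, σ.card = n → IsToggle K c (c σ) (v (c σ))) :
    cycleSpace 𝕜 γ n ≤ boundarySpace 𝕜 γ n := by
  suffices H : ∀ m, ∀ z ∈ cycleSpace 𝕜 γ n,
      z ∈ Finsupp.supported 𝕜 𝕜 {σ | (c σ).card < m} → z ∈ boundarySpace 𝕜 γ n from
    fun z hz => H ((z.support.sup fun σ => (c σ).card) + 1) z hz fun σ hσ =>
      Nat.lt_succ_of_le (Finset.le_sup (f := fun σ => (c σ).card) hσ)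
  intro m
  induction m with
  | zero =>
    intro z _ hzm
    simp only [not_lt_zero, Set.ofPred_false, Finsupp.supported_empty, Submodule.mem_bot] at hzm
    exact hzm ▸ zero_mem _
  | succ m ih =>
    intro z hz hzm
    have hbd : boundary 𝕜 γ (toggleHomotopy 𝕜 γ c v z) ∈ boundarySpace 𝕜 γ n :=
      ⟨_, toggleHomotopy_mem_chainSpace hz.1, rfl⟩
    refine (Submodule.sub_mem_iff_left _ hbd).1 (ih _
      (sub_mem hz (boundarySpace_le_cycleSpace 𝕜 γ n hbd))
      (sub_boundary_toggleHomotopy_mem hc hv hz ?_))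
    simpa only [Nat.lt_succ_iff] using hzm

theorem cycleSpace_le_boundarySpace (hc : Monotone c) {n : ℕ}
    (htoggle : ∀ σ ∈ K, σ.card = n → ∃ w, IsToggle K c (c σ) w) :
    cycleSpace 𝕜 γ n ≤ boundarySpace 𝕜 γ n := by
  by_cases hn : ∃ σ ∈ K, σ.card = n
  · obtain ⟨σ₀, hσ₀, hn₀⟩ := hn
    obtain ⟨w₀, -⟩ := htoggle σ₀ hσ₀ hn₀
    have hexists (D : Finset W) : ∃ w, ∀ σ ∈ K, σ.card = n → c σ = D → IsToggle K c D w := by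
      by_cases hD : ∃ σ ∈ K, σ.card = n ∧ c σ = D
      · obtain ⟨σ, hσ, hn, rfl⟩ := hD
        exact (htoggle σ hσ hn).imp fun w hw _ _ _ _ => hw
      · exact ⟨w₀, fun σ hσ hn hσD => (hD ⟨σ, hσ, hn, hσD⟩).elim⟩
    choose v hv using hexists
    exact cycleSpace_le_boundarySpace_of_forall_isToggle hc fun σ hσ hn => hv _ σ hσ hn rfl
  · push Not at hn
    rw [cycleSpace, chainSpace_eq_bot 𝕜 hn, bot_inf_eq]
    exact bot_le

end Toggle

/-! ### The Hopf trace formula -/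

section HopfTrace

variable {V Γ G : Type*} [LinearOrder Γ] [Group G] {K : FaceComplex V} (γ : ProperColoring K Γ)
  (A : ComplexAction G K) (hγ : A.Preserves γ)

theorem chainSpace_character (n : ℕ) :
    ((permRep ℂ (finsetPerm A.toPerm)).subrepresentation (chainSpace ℂ K n)
      (chainSpace_le_comap ℂ A n)).character = fChar A n :=
  character_supported _ _ _

/-- The character afforded by the reduced cycles of degree `n - 1`. -/
noncomputable def cycleChar (n : ℕ) : G → ℂ :=
  ((permRep ℂ (finsetPerm A.toPerm)).subrepresentation (cycleSpace ℂ γ n)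
    (cycleSpace_le_comap ℂ γ A hγ n)).character

/-- The character afforded by the boundaries of degree `n - 1`. -/
noncomputable def boundaryChar (n : ℕ) : G → ℂ :=
  ((permRep ℂ (finsetPerm A.toPerm)).subrepresentation (boundarySpace ℂ γ n)
    (boundarySpace_le_comap ℂ γ A hγ n)).character

theorem fChar_succ_eq_cycleChar_add_boundaryChar [Finite V] (n : ℕ) :
    fChar A (n + 1) = cycleChar γ A hγ (n + 1) + boundaryChar γ A hγ n := by
  have : FiniteDimensional ℂ (Finset V →₀ ℂ) := inferInstance
  have : FiniteDimensional ℂ (chainSpace ℂ K (n + 1)) := inferInstance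
  rw [← chainSpace_character]
  ext g
  let p : chainSpace ℂ K (n + 1) →ₗ[ℂ] boundarySpace ℂ γ n :=
    (boundary ℂ γ).restrict fun x hx => ⟨x, hx, rfl⟩
  have hsurj : Function.Surjective p := by
    rintro ⟨_, x, hx, rfl⟩
    exact ⟨⟨x, hx⟩, rfl⟩
  have hexact : Function.Exact (Submodule.inclusion (inf_le_left : cycleSpace ℂ γ (n + 1) ≤ _)) p :=
    fun x => ⟨fun hx => ⟨⟨x, x.2, congrArg Subtype.val hx⟩, rfl⟩,
      by rintro ⟨y, rfl⟩; exact Subtype.ext y.2.2⟩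
  exact trace_eq_add_of_exact (Submodule.inclusion_injective _) hsurj hexact rfl
    (LinearMap.ext fun x => Subtype.ext (boundary_permRep ℂ γ A hγ g x))

theorem fChar_zero_eq_cycleChar : fChar A 0 = cycleChar γ A hγ 0 := by
  have hcycle : cycleSpace ℂ γ 0 = chainSpace ℂ K 0 := by
    refine inf_eq_left.2 ?_
    rw [chainSpace_eq_span, Submodule.span_le, Set.image_subset_iff]
    rintro σ ⟨-, hn⟩
    rw [Set.mem_preimage, SetLike.mem_coe, LinearMap.mem_ker, boundary_single,
      Finset.card_eq_zero.1 hn, Finset.sum_empty]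
  rw [← chainSpace_character]
  exact (Representation.char_iso (.mk (LinearEquiv.ofEq _ _ hcycle) fun _ => rfl)).symm

theorem cycleChar_eq_boundaryChar {n : ℕ} (h : cycleSpace ℂ γ n ≤ boundarySpace ℂ γ n) :
    cycleChar γ A hγ n = boundaryChar γ A hγ n :=
  Representation.char_iso (.mk
    (LinearEquiv.ofEq _ _ (h.antisymm (boundarySpace_le_cycleSpace ℂ γ n))) fun _ => rfl)

theorem cycleChar_eq_sum_fChar [Finite V] {n : ℕ}
    (h : ∀ m < n, cycleSpace ℂ γ m ≤ boundarySpace ℂ γ m) :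
    cycleChar γ A hγ n = ∑ j ∈ Finset.range (n + 1), (-1) ^ (n - j) * fChar A j := by
  induction n with
  | zero => simp [fChar_zero_eq_cycleChar γ A hγ]
  | succ n ih =>
    have hsucc : ∑ j ∈ Finset.range (n + 1), (-1) ^ (n + 1 - j) * fChar A j =
        -cycleChar γ A hγ n := by
      rw [ih fun m hm => h m (hm.trans n.lt_succ_self), ← Finset.sum_neg_distrib]
      refine Finset.sum_congr rfl fun j hj => ?_
      rw [Nat.succ_sub (Finset.mem_range_succ_iff.1 hj), pow_succ, mul_neg_one, neg_mul]
    rw [Finset.sum_range_succ, hsucc, Nat.sub_self, pow_zero, one_mul,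
      fChar_succ_eq_cycleChar_add_boundaryChar γ A hγ,
      cycleChar_eq_boundaryChar γ A hγ (h n n.lt_succ_self)]
    ring

theorem homologyRep_character [Finite V] {n : ℕ}
    (hlt : ∀ m < n, cycleSpace ℂ γ m ≤ boundarySpace ℂ γ m) (hgt : ∀ σ ∈ K, σ.card ≤ n) :
    (homologyRep ℂ γ A hγ n).character =
      ∑ j ∈ Finset.range (n + 1), (-1) ^ (n - j) * fChar A j := by
  have hboundary : (boundarySpace ℂ γ n).submoduleOf (cycleSpace ℂ γ n) = ⊥ := by
    rw [boundarySpace, chainSpace_eq_bot ℂ fun σ hσ => (Nat.lt_succ_of_le (hgt σ hσ)).ne,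
      Submodule.map_bot, Submodule.submoduleOf, Submodule.comap_bot, Submodule.ker_subtype]
  rw [← cycleChar_eq_sum_fChar γ A hγ hlt]
  exact (Representation.char_iso
    (.mk (Submodule.quotEquivOfEqBot _ hboundary).symm fun _ => rfl)).symm

end HopfTrace

/-! ### Rank-selected chains of order ideals -/

section RankSelection

theorem insert_mem_orderComplex {Q : Type*} [PartialOrder Q] [DecidableEq Q] {σ : Finset Q} {q : Q}
    (hσ : σ ∈ orderComplex Q) (hq : ∀ r ∈ σ, q ≤ r ∨ r ≤ q) : insert q σ ∈ orderComplex Q := by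
  change IsChain (· ≤ ·) ((insert q σ : Finset Q) : Set Q)
  rw [Finset.coe_insert]
  exact IsChain.insert hσ fun r hr _ => hq r hr

theorem exists_finset_card_eq_forall_le {X Λ : Type*} [Finite X] [LinearOrder Λ] (k : X → Λ)
    {s : ℕ} (hs : s ≤ Nat.card X) :
    ∃ v : Finset X, v.card = s ∧ ∀ y ∈ v, ∀ x ∉ v, k y ≤ k x := by
  classical
  cases nonempty_fintype X
  induction s with
  | zero => exact ⟨∅, rfl, by simp⟩
  | succ s ih =>
    obtain ⟨v, hv, h⟩ := ih (Nat.le_of_succ_le hs)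
    have hne : vᶜ.Nonempty := by
      rw [← Finset.card_pos, Finset.card_compl, ← Nat.card_eq_fintype_card]
      omega
    obtain ⟨u, hu, hmin⟩ := vᶜ.exists_min_image k hne
    rw [Finset.mem_compl] at hu
    refine ⟨insert u v, by rw [Finset.card_insert_of_notMem hu, hv], fun y hy x hx => ?_⟩
    have hxv : x ∉ v := fun hxv => hx (Finset.mem_insert_of_mem hxv)
    rcases Finset.mem_insert.1 hy with rfl | hy
    · exact hmin x (Finset.mem_compl.2 hxv)
    · exact h y hy x hxv

variable {X Λ : Type*} [PartialOrder X] (ω : X → Λ)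

open scoped Classical in
/-- The number of members of `σ` that do not contain `x`. -/
noncomputable def depth (σ : Finset (LowerSet X)) (x : X) : ℕ :=
  (σ.filter fun I => x ∉ I).card

/-- The points of `X` are ordered by their depth in `σ`, and by `ω` within each depth; for a chain
`σ` and a linear extension `ω` this is the linear extension of `X` associated with `σ`. -/
noncomputable def chainKey (σ : Finset (LowerSet X)) (x : X) : Lex (ℕ × Λ) :=
  toLex (depth σ x, ω x)

theorem chainKey_injective (hω : Function.Injective ω) (σ : Finset (LowerSet X)) :
    Function.Injective (chainKey ω σ) := fun _ _ h =>
  hω (congrArg (fun p => (ofLex p).2) h)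

theorem depth_mono (σ : Finset (LowerSet X)) : Monotone (depth σ) := fun _ _ h => by
  classical
  exact Finset.card_le_card (Finset.monotone_filter_right σ fun I _ hx hy => hx (I.lower h hy))

theorem depth_lt_iff {σ : Finset (LowerSet X)} (hσ : σ ∈ orderComplex (LowerSet X)) {x y : X} :
    depth σ y < depth σ x ↔ ∃ I ∈ σ, y ∈ I ∧ x ∉ I := by
  classical
  constructor
  · intro h
    by_contra! h'
    exact h.not_ge (Finset.card_le_card
      (Finset.monotone_filter_right σ fun I hI hx hy => hx (h' I hI hy)))
  · rintro ⟨I, hI, hy, hx⟩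
    refine Finset.card_lt_card (Finset.ssubset_iff_of_subset (fun J hJ => ?_) |>.2
      ⟨I, Finset.mem_filter.2 ⟨hI, hx⟩, fun h => (Finset.mem_filter.1 h).2 hy⟩)
    obtain ⟨hJσ, hyJ⟩ := Finset.mem_filter.1 hJ
    have hJI : J ≤ I := (hσ.total hI hJσ).resolve_left fun h => hyJ (h hy)
    exact Finset.mem_filter.2 ⟨hJσ, fun hxJ => hx (hJI hxJ)⟩

variable [LinearOrder Λ] {ω}

theorem chainKey_lt_chainKey {σ : Finset (LowerSet X)} {x y : X} :
    chainKey ω σ x < chainKey ω σ y ↔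
      depth σ x < depth σ y ∨ depth σ x = depth σ y ∧ ω x < ω y :=
  Prod.Lex.toLex_lt_toLex

theorem chainKey_mono (hω : Monotone ω) (σ : Finset (LowerSet X)) : Monotone (chainKey ω σ) :=
  fun _ _ h => Prod.Lex.toLex_mono ⟨depth_mono σ h, hω h⟩

variable {σ τ : Finset (LowerSet X)} {I v : LowerSet X} {x y : X}

theorem mem_of_chainKey_le (hσ : σ ∈ orderComplex (LowerSet X)) (hI : I ∈ σ)
    (h : chainKey ω σ x ≤ chainKey ω σ y) (hy : y ∈ I) : x ∈ I := by
  by_contra hx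
  exact h.not_gt (chainKey_lt_chainKey.2 (Or.inl ((depth_lt_iff hσ).2 ⟨I, hI, hy, hx⟩)))

theorem exists_mem_of_chainKey_le (hσ : σ ∈ orderComplex (LowerSet X))
    (h : chainKey ω σ x ≤ chainKey ω σ y) (hxy : ω y < ω x) : ∃ I ∈ σ, x ∈ I ∧ y ∉ I := by
  rw [← depth_lt_iff hσ]
  exact (Prod.Lex.toLex_le_toLex.1 h).resolve_right fun h' => h'.2.not_gt hxy

variable (ω) in
/-- The order ideal `v` is an initial segment of `X` in the order associated with `σ`. -/
def IsInitialSegment (σ : Finset (LowerSet X)) (v : LowerSet X) : Prop :=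
  ∀ y ∈ v, ∀ x ∉ v, chainKey ω σ y < chainKey ω σ x

theorem exists_isInitialSegment [Finite X] (hinj : Function.Injective ω) (hmono : Monotone ω)
    (σ : Finset (LowerSet X)) {s : ℕ} (hs : s ≤ Nat.card X) :
    ∃ v : LowerSet X, (v : Set X).ncard = s ∧ IsInitialSegment ω σ v := by
  obtain ⟨w, hw, hle⟩ := exists_finset_card_eq_forall_le (chainKey ω σ) hs
  have hlt : ∀ y ∈ w, ∀ x ∉ w, chainKey ω σ y < chainKey ω σ x := fun y hy x hx =>
    (hle y hy x hx).lt_of_ne fun h => hx (chainKey_injective ω hinj σ h ▸ hy)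
  have hlower : IsLowerSet (w : Set X) := fun y x hxy hy => by
    by_contra hx
    exact (chainKey_mono hmono σ hxy).not_gt (hlt y hy x hx)
  exact ⟨⟨w, hlower⟩, by simpa using hw, hlt⟩

open scoped Classical in
theorem IsInitialSegment.insert_mem_orderComplex (hv : IsInitialSegment ω σ v)
    (hσ : σ ∈ orderComplex (LowerSet X)) : insert v σ ∈ orderComplex (LowerSet X) := by
  refine _root_.insert_mem_orderComplex hσ fun I hI => ?_
  by_contra! h
  obtain ⟨y, hyv, hyI⟩ := Set.not_subset.1 h.1
  obtain ⟨x, hxI, hxv⟩ := Set.not_subset.1 h.2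
  exact hyI (mem_of_chainKey_le hσ hI (hv y hyv x hxv).le hxI)

open scoped Classical in
theorem exists_insert_mem_orderComplex [Finite X] (hσ : σ ∈ orderComplex (LowerSet X)) {s : ℕ}
    (hs : s ≤ Nat.card X) :
    ∃ v : LowerSet X, (v : Set X).ncard = s ∧ insert v σ ∈ orderComplex (LowerSet X) := by
  obtain ⟨v, hvs, hv⟩ := exists_isInitialSegment (ω := (toLinearExtension : X →o _))
    Function.injective_id toLinearExtension.monotone σ hs
  exact ⟨v, hvs, hv.insert_mem_orderComplex hσ⟩

theorem lt_of_notMem_chain (hω : Function.Injective ω) (hτ : τ ∈ orderComplex (LowerSet X))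
    (hvτ : v ∉ τ) {u u' : X} (hu : u ∈ v) (hu' : u' ∉ v)
    (hmax : ∀ y ∈ v, chainKey ω τ y ≤ chainKey ω τ u)
    (hmin : ∀ x ∉ v, chainKey ω τ u' ≤ chainKey ω τ x) (hle : chainKey ω τ u ≤ chainKey ω τ u') :
    ω u < ω u' := by
  by_contra! h
  have hne : u ≠ u' := fun h => hu' (h ▸ hu)
  obtain ⟨J, hJ, huJ, hu'J⟩ :=
    exists_mem_of_chainKey_le hτ hle (h.lt_of_ne fun h => hne (hω h).symm)
  have hJv : v = J := le_antisymm (fun y hy => mem_of_chainKey_le hτ hJ (hmax y hy) huJ)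
    fun x hx => by_contra fun hxv => hu'J (mem_of_chainKey_le hτ hJ (hmin x hxv) hx)
  exact hvτ (hJv ▸ hJ)

variable [Finite X]

variable (ω) in
/-- The pairs on which the order associated with the chain `σ` disagrees with `ω`. -/
noncomputable def inversions (σ : Finset (LowerSet X)) : Finset (X × X) :=
  (Set.toFinite {p : X × X | ω p.1 < ω p.2 ∧ ∃ I ∈ σ, p.2 ∈ I ∧ p.1 ∉ I}).toFinset

theorem mem_inversions : (x, y) ∈ inversions ω σ ↔ ω x < ω y ∧ ∃ I ∈ σ, y ∈ I ∧ x ∉ I :=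
  Set.Finite.mem_toFinset _

theorem inversions_mono : Monotone (inversions (X := X) ω) := by
  rintro τ σ h ⟨x, y⟩ hp
  obtain ⟨hxy, I, hI, hI'⟩ := mem_inversions.1 hp
  exact mem_inversions.2 ⟨hxy, I, h hI, hI'⟩

theorem chainKey_lt_iff_inversions (hω : Function.Injective ω)
    (hσ : σ ∈ orderComplex (LowerSet X)) :
    chainKey ω σ x < chainKey ω σ y ↔
      ω x < ω y ∧ (x, y) ∉ inversions ω σ ∨ (y, x) ∈ inversions ω σ := by
  rw [chainKey_lt_chainKey, mem_inversions, mem_inversions, ← depth_lt_iff hσ, ← depth_lt_iff hσ]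
  rcases lt_trichotomy (ω x) (ω y) with h | h | h
  · simp only [h, h.not_gt, true_and, and_true, false_and, or_false]
    omega
  · simp [hω h]
  · simp only [h, h.not_gt, true_and, and_false, false_and, or_false, false_or]

open scoped Classical in
theorem IsInitialSegment.inversions_insert (hv : IsInitialSegment ω σ v)
    (hσ : σ ∈ orderComplex (LowerSet X)) : inversions ω (insert v σ) = inversions ω σ := by
  refine Finset.Subset.antisymm ?_ (inversions_mono (Finset.subset_insert v σ))
  rintro ⟨x, y⟩ hp
  obtain ⟨hxy, I, hI, hyI, hxI⟩ := mem_inversions.1 hp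
  refine mem_inversions.2 ⟨hxy, ?_⟩
  rcases Finset.mem_insert.1 hI with rfl | hI
  · exact exists_mem_of_chainKey_le hσ (hv y hyI x hxI).le hxy
  · exact ⟨I, hI, hyI, hxI⟩

open scoped Classical in
theorem IsInitialSegment.inversions_erase (hv : IsInitialSegment ω σ v)
    (hσ : σ ∈ orderComplex (LowerSet X)) {u u' : X} (hu : u ∈ v) (hu' : u' ∉ v)
    (hmax : ∀ y ∈ v, chainKey ω σ y ≤ chainKey ω σ u)
    (hmin : ∀ x ∉ v, chainKey ω σ u' ≤ chainKey ω σ x) (huu' : ω u < ω u') :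
    inversions ω (σ.erase v) = inversions ω σ := by
  refine Finset.Subset.antisymm (inversions_mono (Finset.erase_subset v σ)) ?_
  rintro ⟨x, y⟩ hp
  obtain ⟨hxy, I, hI, hyI, hxI⟩ := mem_inversions.1 hp
  by_contra hcon
  have hsep : ∀ J ∈ σ, J ≠ v → y ∈ J → x ∈ J := fun J hJ hJv hyJ => by
    by_contra hxJ
    exact hcon (mem_inversions.2 ⟨hxy, J, Finset.mem_erase.2 ⟨hJv, hJ⟩, hyJ, hxJ⟩)
  obtain rfl : I = v := by_contra fun h => hxI (hsep I hI h hyI)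
  have hy : ω y ≤ ω u := by
    by_contra! h
    obtain ⟨J, hJ, hyJ, huJ⟩ := exists_mem_of_chainKey_le hσ (hmax y hyI) h
    exact huJ (mem_of_chainKey_le hσ hJ (hv u hu x hxI).le
      (hsep J hJ (fun h => huJ (h ▸ hu)) hyJ))
  have hx : ω u' ≤ ω x := by
    by_contra! h
    obtain ⟨J, hJ, huJ, hxJ⟩ := exists_mem_of_chainKey_le hσ (hmin x hxI) h
    exact hxJ (hsep J hJ (fun h => hu' (h ▸ huJ))
      (mem_of_chainKey_le hσ hJ (hv y hyI u' hu').le huJ))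
  exact (hx.trans_lt (hxy.trans_le hy)).not_gt huu'

theorem IsInitialSegment.isToggle (hω : Function.Injective ω)
    (hτ : τ ∈ orderComplex (LowerSet X)) (hv : IsInitialSegment ω τ v) (hvτ : v ∉ τ)
    (hbot : v ≠ ⊥) (htop : v ≠ ⊤) :
    IsToggle (orderComplex (LowerSet X)) (inversions ω) (inversions ω τ) v := by
  intro σ hσ hστ
  have hlt {x y : X} : chainKey ω τ x < chainKey ω τ y ↔ chainKey ω σ x < chainKey ω σ y := by
    rw [chainKey_lt_iff_inversions hω hσ, chainKey_lt_iff_inversions hω hτ, hστ]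
  have hle {x y : X} : chainKey ω τ x ≤ chainKey ω τ y ↔ chainKey ω σ x ≤ chainKey ω σ y := by
    rw [← not_lt, hlt, not_lt]
  have hvσ : IsInitialSegment ω σ v := fun y hy x hx => hlt.1 (hv y hy x hx)
  obtain ⟨u, hu, hmax⟩ := Set.exists_max_image (v : Set X) (chainKey ω τ) (Set.toFinite _)
    (LowerSet.coe_nonempty.2 hbot)
  obtain ⟨u', hu', hmin⟩ := Set.exists_min_image (v : Set X)ᶜ (chainKey ω τ) (Set.toFinite _)
    (Set.nonempty_compl.2 fun h => htop (LowerSet.coe_eq_univ.1 h))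
  have huu' : ω u < ω u' := lt_of_notMem_chain hω hτ hvτ hu hu' hmax hmin (hv u hu u' hu').le
  refine ⟨hvσ.insert_mem_orderComplex hσ, (hvσ.inversions_insert hσ).trans hστ, ?_⟩
  rw [← hστ]
  exact hvσ.inversions_erase hσ hu hu' (fun y hy => hle.1 (hmax y hy))
    (fun x hx => hle.1 (hmin x hx)) huu'

end RankSelection

theorem card_le_of_mem_colorSelect {V Γ : Type*} {K : FaceComplex V} (γ : ProperColoring K Γ)
    (S : Finset Γ) {σ : Finset V} (hσ : σ ∈ colorSelect γ S) : σ.card ≤ S.card :=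
  Finset.card_le_card_of_injOn γ.color hσ.2 (γ.injOn σ hσ.1)

theorem IsToggle.colorSelect {V Γ W : Type*} {K : FaceComplex V} (γ : ProperColoring K Γ)
    {S : Finset Γ} {c : Finset V → Finset W} {D : Finset W} {v : V} (h : IsToggle K c D v)
    (hv : γ.color v ∈ S) : IsToggle (colorSelect γ S) c D v := by
  classical
  intro σ hσ hD
  obtain ⟨hK, hinsert, herase⟩ := h σ hσ.1 hD
  exact ⟨⟨hK, fun u hu => (Finset.mem_insert.1 hu).elim (fun h => h ▸ hv) (hσ.2 u)⟩, hinsert,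
    herase⟩

theorem rankSelected_cycleSpace_le_boundarySpace (𝕜 : Type*) [Field 𝕜] {X : Type*} [PartialOrder X]
    [Finite X] {S : Finset ℕ} (hS : S ⊆ Finset.Icc 1 (Nat.card X - 1)) {n : ℕ} (hn : n < S.card) :
    cycleSpace 𝕜 ((rankColoring X).select S) n ≤ boundarySpace 𝕜 ((rankColoring X).select S) n := by
  classical
  let ω : X → LinearExtension X := toLinearExtension
  have hω : Function.Injective ω := Function.injective_id
  refine cycleSpace_le_boundarySpace (c := inversions ω) inversions_mono fun τ hτ hτn => ?_
  obtain ⟨s, hsS, hsτ⟩ : ∃ s ∈ S, s ∉ τ.image (rankColoring X).color :=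
    Finset.exists_mem_notMem_of_card_lt_card (Finset.card_image_le.trans_lt (hτn.trans_lt hn))
  obtain ⟨hs, hsX⟩ := Finset.mem_Icc.1 (hS hsS)
  obtain ⟨v, rfl, hv⟩ :=
    exists_isInitialSegment hω toLinearExtension.monotone τ (s := s) (by omega)
  refine ⟨v, (hv.isToggle hω hτ.1 (fun h => ?_) ?_ ?_).colorSelect _ hsS⟩
  · exact hsτ (Finset.mem_image_of_mem _ h)
  · rintro rfl
    simp at hs
  · rintro rfl
    rw [LowerSet.coe_top, Set.ncard_univ] at hs hsX
    omega

theorem rankColoring_mem_range {X : Type*} [PartialOrder X] [Finite X] (I : LowerSet X) :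
    (rankColoring X).color I ∈ Finset.range (Nat.card X + 1) :=
  Finset.mem_range_succ_iff.2 (Set.ncard_le_card _)

theorem maxFaceCard_orderComplex (X : Type*) [PartialOrder X] [Finite X] :
    maxFaceCard (orderComplex (LowerSet X)) = Nat.card X + 1 := by
  classical
  have hcard {σ : Finset (LowerSet X)} (hσ : σ ∈ orderComplex (LowerSet X)) :
      σ.card ≤ Nat.card X + 1 := by
    rw [← Finset.card_range (Nat.card X + 1)]
    exact Finset.card_le_card_of_injOn (rankColoring X).color (fun I _ => rankColoring_mem_range I)
      ((rankColoring X).injOn σ hσ)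
  obtain ⟨σ, hσ, hmax⟩ := Set.exists_max_image
    (orderComplex (LowerSet X) : Set (Finset (LowerSet X))) Finset.card (Set.toFinite _)
    ⟨∅, show IsChain _ _ by simp⟩
  have hranks : Finset.range (Nat.card X + 1) ⊆ σ.image (rankColoring X).color := fun s hs => by
    obtain ⟨v, rfl, hv⟩ := exists_insert_mem_orderComplex hσ (Finset.mem_range_succ_iff.1 hs)
    refine Finset.mem_image_of_mem _ (by_contra fun hvσ => ?_)
    exact (hmax _ hv).not_gt (by simp [Finset.card_insert_of_notMem hvσ])
  refine IsGreatest.csSup_eq ⟨⟨σ, hσ, (hcard hσ).antisymm ?_⟩, ?_⟩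
  · simpa using (Finset.card_le_card hranks).trans Finset.card_image_le
  · rintro _ ⟨σ, hσ, rfl⟩
    exact hcard hσ

/-! ### The monomial basis of the Stanley–Reisner ring -/

section MonomialAction

variable {G V : Type*} [Group G] (φ : G →* Equiv.Perm V) (g : G) (u : V →₀ ℕ)

/-- The action on the exponent vectors of monomials induced by an action on the variables. -/
noncomputable def monomialPerm : G →* Equiv.Perm (V →₀ ℕ) where
  toFun g := (Finsupp.domCongr (φ g)).toEquiv
  map_one' := by
    ext u v
    rw [map_one]
    rfl
  map_mul' x y := by
    ext u v
    rw [map_mul]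
    rfl

theorem monomialPerm_apply (v : V) : monomialPerm φ g u v = u ((φ g).symm v) := rfl

theorem monomialPerm_eq_mapDomain : monomialPerm φ g u = u.mapDomain (φ g) :=
  Finsupp.equivMapDomain_eq_mapDomain _ _

theorem support_monomialPerm : (monomialPerm φ g u).support = finsetPerm φ g u.support := by
  ext v
  simp [finsetPerm, monomialPerm_apply]

theorem degree_monomialPerm : (monomialPerm φ g u).degree = u.degree := by
  rw [monomialPerm_eq_mapDomain, Finsupp.degree_mapDomain]

end MonomialAction

theorem sum_single_one_le_iff {V : Type*} {σ : Finset V} {u : V →₀ ℕ} :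
    ∑ v ∈ σ, Finsupp.single v 1 ≤ u ↔ σ ⊆ u.support := by
  classical
  have hsum (w : V) : (∑ v ∈ σ, Finsupp.single v 1 : V →₀ ℕ) w = if w ∈ σ then 1 else 0 := by
    simp [Finsupp.finsetSum_apply, Finsupp.single_apply]
  refine forall_congr' fun w => ?_
  rw [hsum, Finsupp.mem_support_iff]
  split_ifs with hw <;> simp [hw, Nat.one_le_iff_ne_zero]

theorem mem_srIdeal_iff {𝕜 V : Type*} [Field 𝕜] {K : FaceComplex V} {p : MvPolynomial V 𝕜} :
    p ∈ srIdeal 𝕜 K ↔ ∀ u ∈ p.support, u.support ∉ K := by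
  have hgen : {m : MvPolynomial V 𝕜 | ∃ σ : Finset V, σ ∉ K ∧ m = ∏ v ∈ σ, MvPolynomial.X v} =
      (fun s => MvPolynomial.monomial s (1 : 𝕜)) ''
        ((fun σ => ∑ v ∈ σ, Finsupp.single v 1) '' {σ | σ ∉ K}) := by
    rw [Set.image_image]
    simp only [MvPolynomial.monomial_sum_one]
    exact Set.ext fun m => exists_congr fun σ => and_congr_right' eq_comm
  rw [srIdeal, hgen, MvPolynomial.mem_ideal_span_monomial_image]
  refine forall₂_congr fun u _ => ⟨?_, fun hu => ?_⟩
  · rintro ⟨_, ⟨σ, hσ, rfl⟩, hσu⟩ hu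
    exact hσ (K.lower (sum_single_one_le_iff.1 hσu) hu)
  · exact ⟨_, ⟨u.support, hu, rfl⟩, sum_single_one_le_iff.2 subset_rfl⟩

/-- The exponent vectors of degree `i` whose support is a face. -/
def faceMonomials {V : Type*} (K : FaceComplex V) (i : ℕ) : Set (V →₀ ℕ) :=
  {u | u.support ∈ K ∧ u.degree = i}

theorem monomialPerm_mem_faceMonomials {G V : Type*} [Group G] {K : FaceComplex V}
    (A : ComplexAction G K) (i : ℕ) (g : G) (u : V →₀ ℕ) (hu : u ∈ faceMonomials K i) :
    monomialPerm A.toPerm g u ∈ faceMonomials K i := by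
  refine ⟨?_, (degree_monomialPerm _ _ _).trans hu.2⟩
  rw [support_monomialPerm]
  exact A.map_mem g _ hu.1

section MonomialBasis

variable (𝕜 : Type*) [Field 𝕜] {V : Type*} (K : FaceComplex V) (i : ℕ)

/-- The polynomial with the given coefficients at the monomials of degree `i` supported on faces. -/
noncomputable def facePolynomial : (faceMonomials K i →₀ 𝕜) →ₗ[𝕜] MvPolynomial V 𝕜 :=
  Finsupp.linearCombination 𝕜 fun u => MvPolynomial.monomial u.1 1

/-- The class in `𝕜[K]` of the polynomial with the given coefficients at the monomials of degree `i`
supported on faces; this identifies the component of degree `i` with a permutation module. -/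
noncomputable def faceMonomialMap : (faceMonomials K i →₀ 𝕜) →ₗ[𝕜] SRRing 𝕜 K :=
  (Ideal.Quotient.mkₐ 𝕜 (srIdeal 𝕜 K)).toLinearMap ∘ₗ facePolynomial 𝕜 K i

variable {𝕜 K i}

theorem facePolynomial_single (u : faceMonomials K i) (c : 𝕜) :
    facePolynomial 𝕜 K i (Finsupp.single u c) = MvPolynomial.monomial u.1 c := by
  simp [facePolynomial, MvPolynomial.smul_monomial]

theorem coeff_facePolynomial (x : faceMonomials K i →₀ 𝕜) (u : faceMonomials K i) :
    (facePolynomial 𝕜 K i x).coeff u.1 = x u := by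
  classical
  induction x using Finsupp.induction_linear with
  | zero => simp
  | add x y hx hy => simp [hx, hy]
  | single w c =>
    rw [facePolynomial_single, MvPolynomial.coeff_monomial, Finsupp.single_apply]
    simp [Subtype.ext_iff]

theorem faceMonomialMap_single (u : faceMonomials K i) (c : 𝕜) :
    faceMonomialMap 𝕜 K i (Finsupp.single u c) =
      Ideal.Quotient.mk _ (MvPolynomial.monomial u.1 c) :=
  congrArg (Ideal.Quotient.mk _) (facePolynomial_single u c)

theorem faceMonomialMap_injective : Function.Injective (faceMonomialMap 𝕜 K i) := by
  rw [← LinearMap.ker_eq_bot, LinearMap.ker_eq_bot']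
  intro x hx
  have hmem : facePolynomial 𝕜 K i x ∈ srIdeal 𝕜 K := Ideal.Quotient.eq_zero_iff_mem.1 hx
  ext u
  by_contra h
  rw [Finsupp.zero_apply, ← coeff_facePolynomial] at h
  exact mem_srIdeal_iff.1 hmem u.1 (MvPolynomial.mem_support_iff.2 h) u.2.1

theorem mk_monomial_mem_range_faceMonomialMap {u : V →₀ ℕ} (hu : u.degree = i) (c : 𝕜) :
    Ideal.Quotient.mk (srIdeal 𝕜 K) (MvPolynomial.monomial u c) ∈
      LinearMap.range (faceMonomialMap 𝕜 K i) := by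
  by_cases h : u.support ∈ K
  · exact ⟨Finsupp.single ⟨u, h, hu⟩ c, faceMonomialMap_single _ c⟩
  · have hmem : MvPolynomial.monomial u c ∈ srIdeal 𝕜 K := mem_srIdeal_iff.2 fun w hw => by
      rwa [Finset.mem_singleton.1 (MvPolynomial.support_monomial_subset hw)]
    rw [Ideal.Quotient.eq_zero_iff_mem.2 hmem]
    exact zero_mem _

theorem range_faceMonomialMap :
    LinearMap.range (faceMonomialMap 𝕜 K i) = srComponent 𝕜 K i := by
  apply le_antisymm
  · rintro _ ⟨x, rfl⟩
    refine ⟨facePolynomial 𝕜 K i x, ?_, rfl⟩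
    rw [facePolynomial, Finsupp.linearCombination_apply]
    exact Submodule.finsuppSum_mem 𝕜 _ _ _ fun u _ =>
      Submodule.smul_mem _ _ (MvPolynomial.isHomogeneous_monomial 1 u.2.2)
  · rintro _ ⟨p, hp, rfl⟩
    rw [p.as_sum, map_sum]
    refine Submodule.sum_mem _ fun u hu => mk_monomial_mem_range_faceMonomialMap ?_ _
    rw [Finsupp.degree_eq_weight_one]
    exact hp (MvPolynomial.mem_support_iff.1 hu)

end MonomialBasis

section HilbertSeries

variable {G V : Type*} [Group G] {K : FaceComplex V} (A : ComplexAction G K)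

theorem coeff_eqHilb (i : ℕ) :
    PowerSeries.coeff i (eqHilb ℂ A) = permChar (monomialPerm A.toPerm) (faceMonomials K i)
      (monomialPerm_mem_faceMonomials A i) := by
  rw [eqHilb, PowerSeries.coeff_mk]
  let e : (faceMonomials K i →₀ ℂ) ≃ₗ[ℂ] srComponent ℂ K i :=
    (LinearEquiv.ofInjective _ faceMonomialMap_injective).trans
      (LinearEquiv.ofEq _ _ range_faceMonomialMap)
  refine (Representation.char_iso (.mk e fun g =>
    Finsupp.lhom_ext fun u c => Subtype.ext ?_)).symm
  change faceMonomialMap ℂ K i (permRep ℂ _ g (Finsupp.single u c)) =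
    srRep ℂ A g (faceMonomialMap ℂ K i (Finsupp.single u c))
  rw [permRep_single, faceMonomialMap_single, faceMonomialMap_single]
  change Ideal.Quotient.mk _ (MvPolynomial.monomial (monomialPerm A.toPerm g u.1) c) =
    Ideal.Quotient.mk _ (MvPolynomial.rename (A.toPerm g) (MvPolynomial.monomial u.1 c))
  rw [MvPolynomial.rename_monomial, monomialPerm_eq_mapDomain]

theorem coeff_zero_eqHilb (hK : ∅ ∈ K) : PowerSeries.coeff 0 (eqHilb ℂ A) = 1 := by
  have hzero : faceMonomials K 0 = {0} := by
    ext u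
    rw [Set.mem_singleton_iff, ← Finsupp.degree_eq_zero_iff]
    refine ⟨And.right, fun h => ⟨?_, h⟩⟩
    rwa [(Finsupp.degree_eq_zero_iff u).1 h, Finsupp.support_zero]
  have hfixed (g : G) : {u | u ∈ faceMonomials K 0 ∧ monomialPerm A.toPerm g u = u} = {0} := by
    rw [hzero]
    refine Set.Subset.antisymm (fun u hu => hu.1) ?_
    rintro _ rfl
    exact ⟨rfl, by rw [monomialPerm_eq_mapDomain, Finsupp.mapDomain_zero]⟩
  ext g
  rw [coeff_eqHilb, permChar_apply _ _ (hzero ▸ Set.finite_singleton 0), hfixed,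
    Set.ncard_singleton, Pi.one_apply, Nat.cast_one]

end HilbertSeries

/-! ### Lattice points of dilated order polytopes -/

section LatticePoints

variable {X : Type*} [PartialOrder X]

/-- The function on `X` whose value at `x` is the number of members of the multiset `u` of order
ideals that do not contain `x`. -/
noncomputable def height : (LowerSet X →₀ ℕ) →ₗ[ℕ] (X → ℕ) :=
  Finsupp.linearCombination ℕ fun I => (I : Set X)ᶜ.indicator 1

theorem height_single (I : LowerSet X) :
    height (Finsupp.single I 1) = (I : Set X)ᶜ.indicator 1 := by
  rw [height, Finsupp.linearCombination_single, one_smul]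

theorem height_apply (u : LowerSet X →₀ ℕ) (x : X) :
    height u x = ∑ I ∈ u.support, u I * (I : Set X)ᶜ.indicator 1 x := by
  simp [height, Finsupp.linearCombination_apply, Finsupp.sum]

theorem height_le_degree (u : LowerSet X →₀ ℕ) (x : X) : height u x ≤ u.degree := by
  rw [height_apply, Finsupp.degree_apply]
  exact Finset.sum_le_sum fun I _ => mul_le_of_le_one_right' <|
    Set.indicator_le_self' (fun _ _ => zero_le_one) x

theorem height_mono (u : LowerSet X →₀ ℕ) : Monotone (height u) := fun x y hxy => by
  rw [height_apply, height_apply]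
  refine Finset.sum_le_sum fun I _ => Nat.mul_le_mul_left _ ?_
  by_cases hx : x ∈ I
  · simp [hx]
  · have hy : y ∉ I := fun hy => hx (I.lower hxy hy)
    simp [hx, hy]

theorem height_eq_zero_iff (u : LowerSet X →₀ ℕ) (x : X) :
    height u x = 0 ↔ ∀ I ∈ u.support, x ∈ I := by
  rw [height_apply, Finset.sum_eq_zero_iff]
  refine forall₂_congr fun I hI => ?_
  simp [Finsupp.mem_support_iff.1 hI]

theorem exists_eq_add_single_of_mem_faceMonomials {m : ℕ} {u : LowerSet X →₀ ℕ}
    (hu : u ∈ faceMonomials (orderComplex (LowerSet X)) (m + 1)) :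
    ∃ I : LowerSet X, ∃ v ∈ faceMonomials (orderComplex (LowerSet X)) m,
      u = v + Finsupp.single I 1 ∧ ∀ x, x ∈ I ↔ height u x = 0 := by
  have hne : u.support.Nonempty := Finsupp.support_nonempty_iff.2 fun h => by
    simpa [h] using hu.2
  obtain ⟨I, hI, hImin⟩ := u.support.exists_minimal hne
  have hmin : ∀ J ∈ u.support, I ≤ J := fun J hJ => (hu.1.total hI hJ).elim id (hImin hJ)
  have hadd : u = u - Finsupp.single I 1 + Finsupp.single I 1 :=
    (tsub_add_cancel_of_le (Finsupp.single_le_iff.2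
      (Nat.one_le_iff_ne_zero.2 (Finsupp.mem_support_iff.1 hI)))).symm
  refine ⟨I, u - Finsupp.single I 1,
    ⟨LowerSet.lower _ (Finsupp.support_mono tsub_le_self) hu.1, ?_⟩, hadd, fun x => ?_⟩
  · have hdegree := hu.2
    rw [hadd, map_add, Finsupp.degree_single] at hdegree
    exact Nat.add_right_cancel hdegree
  · rw [height_eq_zero_iff]
    exact ⟨fun hx J hJ => hmin J hJ hx, fun h => h I hI⟩

theorem height_injOn (m : ℕ) :
    Set.InjOn height (faceMonomials (orderComplex (LowerSet X)) m) := by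
  induction m with
  | zero =>
    intro u hu u' hu' _
    rw [(Finsupp.degree_eq_zero_iff u).1 hu.2, (Finsupp.degree_eq_zero_iff u').1 hu'.2]
  | succ m ih =>
    intro u hu u' hu' h
    obtain ⟨I, v, hv, rfl, hI⟩ := exists_eq_add_single_of_mem_faceMonomials hu
    obtain ⟨I', v', hv', rfl, hI'⟩ := exists_eq_add_single_of_mem_faceMonomials hu'
    obtain rfl : I = I' := LowerSet.ext <| Set.ext fun x => by
      have hIx := hI x
      rw [congrFun h x] at hIx
      exact hIx.trans (hI' x).symm
    rw [map_add, map_add] at h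
    rw [ih hv hv' (add_right_cancel h)]

theorem exists_height_eq {m : ℕ} {h : X → ℕ} (hmono : Monotone h) (hle : ∀ x, h x ≤ m) :
    ∃ u ∈ faceMonomials (orderComplex (LowerSet X)) m, height u = h := by
  classical
  let I (j : ℕ) : LowerSet X := ⟨{x | h x ≤ j}, fun _ _ hxy hy => (hmono hxy).trans hy⟩
  have hI : Monotone I := fun j k hjk x hx => le_trans hx hjk
  refine ⟨∑ j ∈ Finset.range m, Finsupp.single (I j) 1, ⟨?_, by simp⟩, funext fun x => ?_⟩
  · have hsupport : (∑ j ∈ Finset.range m, Finsupp.single (I j) 1).support ⊆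
        (Finset.range m).image I := by
      intro J hJ
      obtain ⟨j, hj, hJ⟩ := Finset.mem_biUnion.1 (Finsupp.support_finsetSum hJ)
      rw [Finset.mem_singleton.1 (Finsupp.support_single_subset hJ)]
      exact Finset.mem_image_of_mem I hj
    refine LowerSet.lower _ hsupport (hI.isChain_range.mono ?_)
    rw [Finset.coe_image]
    exact Set.image_subset_range _ _
  · have hfilter : (Finset.range m).filter (fun j => j < h x) = Finset.range (h x) := by
      ext j
      have := hle x
      simp only [Finset.mem_filter, Finset.mem_range]
      omega
    rw [map_sum, Finset.sum_apply, ← Finset.card_range (h x), ← hfilter, Finset.card_filter]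
    refine Finset.sum_congr rfl fun j _ => ?_
    have hmem : x ∈ I j ↔ h x ≤ j := Iff.rfl
    by_cases hj : h x ≤ j
    · simp [height_single, hmem, hj]
    · simp [height_single, hmem, hj, not_le.1 hj]

theorem cast_mem_smul_orderPolytope {m : ℕ} (hm : m ≠ 0) {h : X → ℕ} (hmono : Monotone h)
    (hle : ∀ x, h x ≤ m) :
    (fun x => (h x : ℝ)) ∈ ((m : ℝ) • orderPolytope X) ∩ (intLattice X : Set (X → ℝ)) := by
  have hm₀ : (0 : ℝ) < m := Nat.cast_pos.2 (Nat.pos_of_ne_zero hm)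
  refine ⟨⟨fun x => (h x : ℝ) / m, fun x y hxy => ⟨by positivity, ?_, ?_⟩, ?_⟩,
    fun x => ⟨h x, by simp⟩⟩
  · exact div_le_div_of_nonneg_right (Nat.cast_le.2 (hmono hxy)) hm₀.le
  · exact (div_le_one hm₀).2 (Nat.cast_le.2 (hle y))
  · exact funext fun x => mul_div_cancel₀ _ hm₀.ne'

theorem exists_eq_cast_of_mem_smul_orderPolytope {m : ℕ} {f : X → ℝ}
    (hf : f ∈ ((m : ℝ) • orderPolytope X) ∩ (intLattice X : Set (X → ℝ))) :
    ∃ h : X → ℕ, Monotone h ∧ (∀ x, h x ≤ m) ∧ f = fun x => (h x : ℝ) := by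
  obtain ⟨⟨p, hp, rfl⟩, hint⟩ := hf
  have hnat (x : X) : ∃ n : ℕ, (m : ℝ) * p x = n := by
    obtain ⟨k, hk⟩ := hint x
    have hk₀ : (0 : ℝ) ≤ k := hk ▸ mul_nonneg m.cast_nonneg (hp x x le_rfl).1
    obtain ⟨n, rfl⟩ := Int.eq_ofNat_of_zero_le (Int.cast_nonneg_iff.1 hk₀)
    exact ⟨n, hk⟩
  choose h hh using hnat
  refine ⟨h, fun x y hxy => ?_, fun x => ?_, funext hh⟩
  · rw [← Nat.cast_le (α := ℝ), ← hh, ← hh]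
    exact mul_le_mul_of_nonneg_left (hp x y hxy).2.1 m.cast_nonneg
  · rw [← Nat.cast_le (α := ℝ), ← hh]
    exact mul_le_of_le_one_right m.cast_nonneg (hp x x le_rfl).2.2

theorem height_bijOn {m : ℕ} (hm : m ≠ 0) :
    Set.BijOn (fun (u : LowerSet X →₀ ℕ) (x : X) => (height u x : ℝ))
      (faceMonomials (orderComplex (LowerSet X)) m)
      (((m : ℝ) • orderPolytope X) ∩ (intLattice X : Set (X → ℝ))) := by
  refine ⟨fun u hu => ?_, fun u hu u' hu' h => ?_, fun f hf => ?_⟩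
  · exact cast_mem_smul_orderPolytope hm (height_mono u) fun x => hu.2 ▸ height_le_degree u x
  · exact height_injOn m hu hu' (funext fun x => Nat.cast_injective (congrFun h x))
  · obtain ⟨h, hmono, hle, rfl⟩ := exists_eq_cast_of_mem_smul_orderPolytope hf
    obtain ⟨u, hu, rfl⟩ := exists_height_eq hmono hle
    exact ⟨u, hu, rfl⟩

variable {G : Type*} [Group G] (a : G →* (X ≃o X))

theorem mem_idealAction_iff (g : G) (I : LowerSet X) (x : X) :
    x ∈ (idealAction a).toPerm g I ↔ a g⁻¹ x ∈ I := by
  change x ∈ a g '' (I : Set X) ↔ _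
  rw [map_inv]
  exact Set.mem_image_equiv (f := (a g).toEquiv)

theorem height_monomialPerm (g : G) (u : LowerSet X →₀ ℕ) (x : X) :
    height (monomialPerm (idealAction a).toPerm g u) x = height u (a g⁻¹ x) := by
  classical
  rw [monomialPerm_eq_mapDomain, height, Finsupp.linearCombination_mapDomain,
    Finsupp.linearCombination_apply, Finsupp.linearCombination_apply, Finsupp.sum, Finsupp.sum,
    Finset.sum_apply, Finset.sum_apply]
  refine Finset.sum_congr rfl fun I _ => ?_
  simp [Set.indicator_apply, mem_idealAction_iff]

theorem coordRep_image_orderPolytope (g : G) :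
    coordRep a g '' orderPolytope X = orderPolytope X := by
  have hmaps (g : G) : Set.MapsTo (coordRep a g) (orderPolytope X) (orderPolytope X) :=
    fun f hf x y hxy => hf _ _ ((a g⁻¹).monotone hxy)
  refine (hmaps g).image_subset.antisymm fun f hf => ⟨coordRep a g⁻¹ f, hmaps g⁻¹ hf, ?_⟩
  rw [← LinearEquiv.mul_apply, ← map_mul, mul_inv_cancel, map_one, LinearEquiv.coe_one, id]

theorem eqEhr_eq_eqHilb (hP : ∀ g, coordRep a g '' orderPolytope X = orderPolytope X) :
    eqEhr (coordRep a) (intLattice X) (coordRep_intLattice a) (orderPolytope X) hP =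
      eqHilb ℂ (idealAction a) := by
  ext m : 1
  rw [eqEhr, PowerSeries.coeff_mk]
  split_ifs with hm
  · subst hm
    exact (coeff_zero_eqHilb _ (show IsChain _ _ by simp)).symm
  · rw [coeff_eqHilb]
    exact (permChar_congr (height_bijOn hm) fun g u _ =>
      funext fun x => congrArg Nat.cast (height_monomialPerm a g u x)).symm

end LatticePoints

/-! ### The flag transform -/

section FlagTransform

variable {Γ R : Type*}

/-- The passage from flag `f`-vectors to flag `h`-vectors. -/
def flagTransform [Ring R] (f : Finset Γ → R) (S : Finset Γ) : R :=
  ∑ T ∈ S.powerset, (-1) ^ (S.card - T.card) * f T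

theorem flagTransform_eq_zero_of_insert [DecidableEq Γ] [Ring R] {f : Finset Γ → R} {c : Γ}
    (hf : ∀ T, c ∉ T → f (insert c T) = f T) {S : Finset Γ} (hc : c ∈ S) :
    flagTransform f S = 0 := by
  rw [flagTransform, ← Finset.insert_erase hc, Finset.sum_powerset_insert (Finset.notMem_erase _ _),
    ← Finset.sum_add_distrib]
  refine Finset.sum_eq_zero fun T hT => ?_
  have hTS := Finset.mem_powerset.1 hT
  have hcT : c ∉ T := fun h => Finset.notMem_erase _ _ (hTS h)
  rw [hf T hcT, Finset.card_insert_of_notMem (Finset.notMem_erase _ _),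
    Finset.card_insert_of_notMem hcT, Nat.add_sub_add_right,
    Nat.sub_add_comm (Finset.card_le_card hTS), pow_succ, mul_neg_one, neg_mul, neg_add_cancel]

theorem sum_Icc_pow_card_sub [DecidableEq Γ] [CommSemiring R] {T C : Finset Γ} (hTC : T ⊆ C)
    (a : R) : ∑ S ∈ Finset.Icc T C, a ^ (S.card - T.card) = (a + 1) ^ (C.card - T.card) := by
  have hdisjoint {W : Finset Γ} (hW : W ∈ (C \ T).powerset) : Disjoint T W :=
    (Finset.subset_sdiff.1 (Finset.mem_powerset.1 hW)).2.symm
  rw [Finset.Icc_eq_image_powerset hTC, Finset.sum_image fun W hW W' hW' h => by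
      rw [← (hdisjoint hW).sup_sdiff_cancel_left, ← (hdisjoint hW').sup_sdiff_cancel_left]
      exact congrArg (· \ T) h,
    ← Finset.card_sdiff_of_subset hTC, ← Finset.sum_pow_mul_eq_add_pow]
  refine Finset.sum_congr rfl fun W hW => ?_
  rw [Finset.card_union_of_disjoint (hdisjoint hW), Nat.add_sub_cancel_left, one_pow, mul_one]

variable [CommRing R]

theorem sum_flagTransform_mul_pow (f : Finset Γ → R) (C : Finset Γ) (a : R) :
    ∑ S ∈ C.powerset, flagTransform f S * a ^ S.card =
      ∑ T ∈ C.powerset, f T * (a ^ T.card * (1 - a) ^ (C.card - T.card)) := by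
  classical
  calc ∑ S ∈ C.powerset, flagTransform f S * a ^ S.card
      = ∑ S ∈ C.powerset, ∑ T ∈ S.powerset, f T * (a ^ T.card * (-a) ^ (S.card - T.card)) :=
        Finset.sum_congr rfl fun S _ => by
          rw [flagTransform, Finset.sum_mul]
          refine Finset.sum_congr rfl fun T hT => ?_
          rw [← pow_mul_pow_sub a (Finset.card_le_card (Finset.mem_powerset.1 hT)), neg_pow a]
          ring
    _ = ∑ T ∈ C.powerset, ∑ S ∈ Finset.Icc T C, f T * (a ^ T.card * (-a) ^ (S.card - T.card)) :=
        Finset.sum_comm' fun S T => by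
          simp only [Finset.mem_powerset, Finset.mem_Icc]
          exact ⟨fun h => ⟨⟨h.2, h.1⟩, h.2.trans h.1⟩, fun h => ⟨h.1.2, h.1.1⟩⟩
    _ = _ := Finset.sum_congr rfl fun T hT => by
          rw [← Finset.mul_sum, ← Finset.mul_sum, sum_Icc_pow_card_sub (Finset.mem_powerset.1 hT),
            neg_add_eq_sub]

theorem coeff_one_sub_X_pow (n k : ℕ) :
    ((1 - Polynomial.X) ^ n : Polynomial R).coeff k = (-1) ^ k * n.choose k := by
  have hcomp : ((1 - Polynomial.X) ^ n : Polynomial R) =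
      ((1 + Polynomial.X) ^ n : Polynomial R).comp (Polynomial.C (-1) * Polynomial.X) := by
    simp [sub_eq_add_neg]
  rw [hcomp, Polynomial.comp_C_mul_X_coeff, Polynomial.coeff_one_add_X_pow, mul_comm]

/-- This compares the coefficients of `t ^ k` in `sum_flagTransform_mul_pow` for `a = t`. -/
theorem sum_powersetCard_flagTransform (f : Finset Γ → R) (C : Finset Γ) (k : ℕ) :
    ∑ S ∈ C.powersetCard k, flagTransform f S =
      ∑ i ∈ Finset.range (k + 1), (-1) ^ (k - i) * ((C.card - i).choose (k - i) : R) *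
        ∑ T ∈ C.powersetCard i, f T := by
  classical
  have hC (S : Finset Γ) :
      flagTransform (fun T => Polynomial.C (f T)) S = Polynomial.C (flagTransform f S) := by
    simp [flagTransform]
  have hcoeff := congrArg (Polynomial.coeff · k)
    (sum_flagTransform_mul_pow (fun T => Polynomial.C (f T)) C Polynomial.X)
  simp only [hC, Polynomial.finsetSum_coeff, Polynomial.coeff_C_mul, Polynomial.coeff_X_pow,
    Polynomial.coeff_X_pow_mul', coeff_one_sub_X_pow, mul_ite, mul_one, mul_zero,
    ← Finset.sum_filter] at hcoeff
  have hmaps : ∀ T ∈ C.powerset.filter (·.card ≤ k), T.card ∈ Finset.range (k + 1) := fun T hT =>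
    Finset.mem_range_succ_iff.2 (Finset.mem_filter.1 hT).2
  rw [Finset.powersetCard_eq_filter]
  simp only [eq_comm (a := k)] at hcoeff
  rw [hcoeff, ← Finset.sum_fiberwise_of_maps_to hmaps]
  refine Finset.sum_congr rfl fun i hi => ?_
  have hfilter : (C.powerset.filter (·.card ≤ k)).filter (·.card = i) = C.powersetCard i := by
    rw [Finset.filter_filter, Finset.powersetCard_eq_filter]
    exact Finset.filter_congr fun T _ =>
      and_iff_right_of_imp fun h => h ▸ Finset.mem_range_succ_iff.1 hi
  rw [hfilter, Finset.mul_sum]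
  refine Finset.sum_congr rfl fun T hT => ?_
  rw [(Finset.mem_powersetCard.1 hT).2, mul_comm]

end FlagTransform

/-! ### Invariant faces -/

section InvariantFaces

variable {V Γ G : Type*} [Group G] {K : FaceComplex V} (A : ComplexAction G K)

open scoped Classical in
/-- The faces of `K` that are mapped to themselves by `g`. -/
noncomputable def invariantFaces [Fintype V] (g : G) : Finset (Finset V) :=
  Finset.univ.filter fun σ => σ ∈ K ∧ finsetPerm A.toPerm g σ = σ

theorem mem_invariantFaces [Fintype V] {g : G} {σ : Finset V} :
    σ ∈ invariantFaces A g ↔ σ ∈ K ∧ finsetPerm A.toPerm g σ = σ := by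
  simp [invariantFaces]

theorem fChar_apply [Fintype V] (n : ℕ) (g : G) :
    fChar A n g = ((invariantFaces A g).filter fun σ => σ.card = n).card := by
  rw [fChar, permChar_apply _ _ (Set.toFinite _), ← Set.ncard_coe_finset]
  congr 2
  ext σ
  simp only [Finset.coe_filter, mem_invariantFaces, Set.mem_ofPred_eq]
  exact and_right_comm

variable (γ : ProperColoring K Γ)

theorem card_image_color [DecidableEq Γ] {σ : Finset V} (hσ : σ ∈ K) :
    (σ.image γ.color).card = σ.card :=
  Finset.card_image_of_injOn (γ.injOn σ hσ)

variable (hγ : A.Preserves γ)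

theorem flagFChar_apply [Fintype V] [DecidableEq Γ] (T : Finset Γ) (g : G) :
    flagFChar A γ hγ T g =
      ((invariantFaces A g).filter fun σ => σ.image γ.color = T).card := by
  rw [flagFChar, permChar_apply _ _ (Set.toFinite _), ← Set.ncard_coe_finset]
  congr 2
  ext σ
  simp only [Finset.coe_filter, mem_invariantFaces, ← Finset.coe_image, Finset.coe_inj,
    Set.mem_ofPred_eq]
  exact and_right_comm

theorem sum_flagFChar_mul [Fintype V] {C : Finset Γ}
    (hC : ∀ σ ∈ K, ∀ v ∈ σ, γ.color v ∈ C) (g : G) (w : ℕ → ℂ) :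
    ∑ T ∈ C.powerset, flagFChar A γ hγ T g * w T.card =
      ∑ σ ∈ invariantFaces A g, w σ.card := by
  classical
  have hmaps : ∀ σ ∈ invariantFaces A g, σ.image γ.color ∈ C.powerset := fun σ hσ =>
    Finset.mem_powerset.2 <| Finset.image_subset_iff.2 <|
      hC σ ((mem_invariantFaces A).1 hσ).1
  rw [← Finset.sum_fiberwise_of_maps_to hmaps]
  refine Finset.sum_congr rfl fun T _ => ?_
  rw [flagFChar_apply, ← nsmul_eq_mul]
  refine (Finset.sum_eq_card_nsmul fun σ hσ => ?_).symm
  obtain ⟨hσ, hT⟩ := Finset.mem_filter.1 hσ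
  rw [← hT, card_image_color γ ((mem_invariantFaces A).1 hσ).1]

theorem fChar_eq_sum_flagFChar [Finite V] {C : Finset Γ}
    (hC : ∀ σ ∈ K, ∀ v ∈ σ, γ.color v ∈ C) (n : ℕ) :
    fChar A n = ∑ T ∈ C.powersetCard n, flagFChar A γ hγ T := by
  classical
  cases nonempty_fintype V
  ext g
  have hsum := sum_flagFChar_mul A γ hγ hC g fun k => if k = n then 1 else 0
  rw [fChar_apply, Finset.sum_apply, Finset.powersetCard_eq_filter, Finset.sum_filter]
  simpa only [mul_ite, mul_one, mul_zero, Finset.sum_boole] using hsum.symm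

theorem flagFChar_select {S T : Finset Γ} (hT : T ⊆ S) :
    flagFChar (A.select γ hγ S) (γ.select S) hγ T = flagFChar A γ hγ T := by
  refine permChar_congr (f := id) ⟨fun σ h => ⟨h.1.1, h.2⟩, Set.injOn_id _, fun σ h =>
    ⟨σ, ⟨⟨h.1, fun v hv => hT ?_⟩, h.2⟩, rfl⟩⟩ fun _ _ _ => rfl
  exact Finset.mem_coe.1 (h.2 ▸ Set.mem_image_of_mem γ.color hv)

theorem flagHChar_eq_sum_fChar_select [Finite V] (S : Finset Γ) :
    flagHChar A γ hγ S =
      ∑ n ∈ Finset.range (S.card + 1), (-1) ^ (S.card - n) * fChar (A.select γ hγ S) n := by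
  rw [flagHChar, Finset.sum_powerset]
  refine Finset.sum_congr rfl fun n _ => ?_
  rw [fChar_eq_sum_flagFChar (A.select γ hγ S) (γ.select S) hγ (C := S) (fun σ hσ => hσ.2),
    Finset.mul_sum]
  refine Finset.sum_congr rfl fun T hT => ?_
  obtain ⟨hTS, hTn⟩ := Finset.mem_powersetCard.1 hT
  rw [flagFChar_select A γ hγ hTS, hTn]

theorem hChar_eq_sum_flagHChar [Finite V] {C : Finset Γ}
    (hC : ∀ σ ∈ K, ∀ v ∈ σ, γ.color v ∈ C) (hK : maxFaceCard K = C.card) (k : ℕ) :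
    hChar A k = ∑ S ∈ C.powersetCard k, flagHChar A γ hγ S := by
  rw [hChar, hK]
  simp only [fChar_eq_sum_flagFChar A γ hγ hC]
  exact (sum_powersetCard_flagTransform (flagFChar A γ hγ) C k).symm

/-- Adding or removing a cone point is an equivariant bijection of faces. -/
theorem flagFChar_insert_of_cone [DecidableEq V] [DecidableEq Γ] {v : V}
    (hv : ∀ w, γ.color w = γ.color v → w = v) (hcone : ∀ σ ∈ K, insert v σ ∈ K) {T : Finset Γ}
    (hT : γ.color v ∉ T) :
    flagFChar A γ hγ (insert (γ.color v) T) = flagFChar A γ hγ T := by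
  have hvσ {σ : Finset V} (hσ : γ.color '' (σ : Set V) = T) : v ∉ σ := fun h =>
    hT (Finset.mem_coe.1 (hσ ▸ Set.mem_image_of_mem γ.color h))
  refine (permChar_congr (f := insert v) ⟨?_, ?_, ?_⟩ ?_).symm
  · rintro σ ⟨hσ, hσT⟩
    refine ⟨hcone σ hσ, ?_⟩
    rw [Finset.coe_insert, Set.image_insert_eq, hσT, Finset.coe_insert]
  · rintro σ ⟨-, hσ⟩ σ' ⟨-, hσ'⟩ h
    rw [← Finset.erase_insert (hvσ hσ), h, Finset.erase_insert (hvσ hσ')]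
  · rintro σ ⟨hσ, hσT⟩
    rw [Finset.coe_insert] at hσT
    obtain ⟨w, hw, hwv⟩ : γ.color v ∈ γ.color '' (σ : Set V) := hσT ▸ Set.mem_insert _ _
    obtain rfl := hv w hwv
    refine ⟨σ.erase w, ⟨K.lower (Finset.erase_subset w σ) hσ, ?_⟩, Finset.insert_erase hw⟩
    rw [Finset.coe_erase, (γ.injOn σ hσ).image_sdiff_subset (Set.singleton_subset_iff.2 hw), hσT,
      Set.image_singleton, Set.insert_sdiff_self_of_notMem (mt Finset.mem_coe.1 hT)]
  · intro g σ _
    change insert v (σ.map (A.toPerm g).toEmbedding) = (insert v σ).map (A.toPerm g).toEmbedding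
    rw [Finset.map_insert]
    exact congrArg (insert · _) (hv _ (hγ g v)).symm

theorem flagHChar_eq_zero_of_cone [DecidableEq V] {v : V}
    (hv : ∀ w, γ.color w = γ.color v → w = v) (hcone : ∀ σ ∈ K, insert v σ ∈ K) {S : Finset Γ}
    (hS : γ.color v ∈ S) : flagHChar A γ hγ S = 0 := by
  classical
  exact flagTransform_eq_zero_of_insert (fun _ => flagFChar_insert_of_cone A γ hγ hv hcone) hS

end InvariantFaces

/-! ### The Hilbert series in terms of the flag `h`-vector -/

open scoped Classical in
theorem coeff_X_mul_mk_one_pow {ι R : Type*} [CommSemiring R] (σ : Finset ι) (m : ℕ) :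
    PowerSeries.coeff m ((PowerSeries.X * PowerSeries.mk 1 : PowerSeries R) ^ σ.card) =
      ((σ.finsuppAntidiag m).filter fun u => u.support = σ).card := by
  have hcoeff (n : ℕ) : PowerSeries.coeff n (PowerSeries.X * PowerSeries.mk 1 : PowerSeries R) =
      if n ≠ 0 then 1 else 0 := by
    cases n <;> simp [PowerSeries.coeff_succ_X_mul]
  rw [← Finset.prod_const, PowerSeries.coeff_prod, ← Finset.sum_boole]
  refine Finset.sum_congr rfl fun u hu => ?_
  simp only [hcoeff, Finset.prod_ite_zero, Finset.prod_const_one]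
  have hsub := (Finset.mem_finsuppAntidiag.1 hu).2
  refine if_congr ⟨fun h => hsub.antisymm fun i hi => Finsupp.mem_support_iff.2 (h i hi), ?_⟩
    rfl rfl
  exact fun h i hi => Finsupp.mem_support_iff.1 (h ▸ hi)

section HilbertSeries

variable {V Γ G : Type*} [Group G] {K : FaceComplex V} (A : ComplexAction G K)
  (γ : ProperColoring K Γ)

/-- An invariant face is fixed vertexwise, since its vertices have distinct colors. -/
theorem monomialPerm_eq_self_iff (hγ : A.Preserves γ) {u : V →₀ ℕ} (hu : u.support ∈ K) (g : G) :
    monomialPerm A.toPerm g u = u ↔ finsetPerm A.toPerm g u.support = u.support := by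
  refine ⟨fun h => by rw [← support_monomialPerm, h], fun h => ?_⟩
  have hfix : ∀ v ∈ u.support, A.toPerm g v = v := fun v hv =>
    γ.injOn _ hu (h ▸ Finset.mem_map_of_mem _ hv) hv (hγ g v)
  rw [monomialPerm_eq_mapDomain]
  exact (Finsupp.mapDomain_congr hfix).trans Finsupp.mapDomain_id

theorem coeff_eqHilb_apply [Fintype V] (hγ : A.Preserves γ) (m : ℕ) (g : G) :
    PowerSeries.coeff m (eqHilb ℂ A) g = ∑ σ ∈ invariantFaces A g,
      PowerSeries.coeff m ((PowerSeries.X * PowerSeries.mk 1 : PowerSeries ℂ) ^ σ.card) := by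
  classical
  have hfinite : (faceMonomials K m).Finite :=
    (Finsupp.finite_of_degree_le m).subset fun u hu => hu.2.le
  have hset : {u | u ∈ faceMonomials K m ∧ monomialPerm A.toPerm g u = u} =
      (invariantFaces A g).biUnion fun σ =>
        (σ.finsuppAntidiag m).filter fun u => u.support = σ := by
    ext u
    simp only [Finset.coe_biUnion, Finset.coe_filter, Set.mem_iUnion, Set.mem_ofPred_eq,
      Finset.mem_finsuppAntidiag, SetLike.mem_coe, mem_invariantFaces, exists_prop]
    constructor
    · rintro ⟨hu, hfix⟩
      exact ⟨u.support, ⟨hu.1, (monomialPerm_eq_self_iff A γ hγ hu.1 g).1 hfix⟩, ⟨hu.2, subset_rfl⟩,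
        rfl⟩
    · rintro ⟨_, ⟨hK, hfix⟩, ⟨hdegree, -⟩, rfl⟩
      exact ⟨⟨hK, hdegree⟩, (monomialPerm_eq_self_iff A γ hγ hK g).2 hfix⟩
  rw [coeff_eqHilb, permChar_apply _ _ hfinite, hset, Set.ncard_coe_finset, Finset.card_biUnion]
  · simp only [coeff_X_mul_mk_one_pow, Nat.cast_sum]
  · intro σ _ σ' _ hne
    exact Finset.disjoint_left.2 fun u hu hu' =>
      hne ((Finset.mem_filter.1 hu).2.symm.trans (Finset.mem_filter.1 hu').2)

variable (hγ : A.Preserves γ)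

theorem eqHilb_eq_sum_flagFChar [Finite V] {C : Finset Γ}
    (hC : ∀ σ ∈ K, ∀ v ∈ σ, γ.color v ∈ C) :
    eqHilb ℂ A = ∑ T ∈ C.powerset, PowerSeries.C (flagFChar A γ hγ T) *
      (PowerSeries.X * PowerSeries.mk 1) ^ T.card := by
  cases nonempty_fintype V
  ext m g
  have hcoeff (n : ℕ) :
      PowerSeries.coeff m ((PowerSeries.X * PowerSeries.mk 1 : PowerSeries (G → ℂ)) ^ n) g =
        PowerSeries.coeff m ((PowerSeries.X * PowerSeries.mk 1 : PowerSeries ℂ) ^ n) := by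
    rw [← Finset.card_range n, coeff_X_mul_mk_one_pow, coeff_X_mul_mk_one_pow, Pi.natCast_apply]
  rw [coeff_eqHilb_apply A γ hγ, ← sum_flagFChar_mul A γ hγ hC g fun n =>
    PowerSeries.coeff m ((PowerSeries.X * PowerSeries.mk 1 : PowerSeries ℂ) ^ n)]
  simp only [map_sum, Finset.sum_apply, PowerSeries.coeff_C_mul, Pi.mul_apply, hcoeff]

theorem eqHilb_eq_invOneSubPow_mul_sum [Finite V] {C : Finset Γ}
    (hC : ∀ σ ∈ K, ∀ v ∈ σ, γ.color v ∈ C) :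
    eqHilb ℂ A = ↑(PowerSeries.invOneSubPow (G → ℂ) C.card) *
      ∑ S ∈ C.powerset, PowerSeries.C (flagHChar A γ hγ S) * PowerSeries.X ^ S.card := by
  have hflag (S : Finset Γ) : PowerSeries.C (flagHChar A γ hγ S) =
      flagTransform (fun T => PowerSeries.C (flagFChar A γ hγ T)) S := by
    simp [flagHChar, flagTransform]
  have hinv : (↑(PowerSeries.invOneSubPow (G → ℂ) C.card)⁻¹ : PowerSeries (G → ℂ)) =
      (1 - PowerSeries.X) ^ C.card := PowerSeries.invOneSubPow_inv_eq_one_sub_pow _ _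
  have hgeom : (1 - PowerSeries.X) * (PowerSeries.X * PowerSeries.mk 1) =
      (PowerSeries.X : PowerSeries (G → ℂ)) := by
    rw [mul_left_comm, mul_comm (1 - _), PowerSeries.mk_one_mul_one_sub_eq_one, mul_one]
  simp only [hflag]
  rw [sum_flagTransform_mul_pow, ← Units.inv_mul_eq_iff_eq_mul, hinv,
    eqHilb_eq_sum_flagFChar A γ hγ hC, Finset.mul_sum]
  refine Finset.sum_congr rfl fun T hT => ?_
  rw [mul_left_comm, ← pow_mul_pow_sub _ (Finset.card_le_card (Finset.mem_powerset.1 hT)),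
    mul_right_comm, ← mul_pow, hgeom]

end HilbertSeries

/-! ### The order complex of `J(X)` -/

theorem finiteDimensional_subQuotient {𝕜 C : Type*} [Field 𝕜] [AddCommGroup C] [Module 𝕜 C]
    [FiniteDimensional 𝕜 C] (Z B : Submodule 𝕜 C) : FiniteDimensional 𝕜 (SubQuotient Z B) :=
  inferInstanceAs (FiniteDimensional 𝕜 (Z ⧸ B.submoduleOf Z))

section OrderIdeals

variable {X : Type*} [PartialOrder X] [Finite X]

theorem rankColoring_bot : (rankColoring X).color ⊥ = 0 := Set.ncard_empty X

theorem rankColoring_top : (rankColoring X).color ⊤ = Nat.card X := Set.ncard_univ X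

theorem rankColoring_eq_zero_iff {I : LowerSet X} : (rankColoring X).color I = 0 ↔ I = ⊥ :=
  (Set.ncard_eq_zero (Set.toFinite _)).trans LowerSet.coe_eq_empty

theorem rankColoring_eq_card_iff {I : LowerSet X} :
    (rankColoring X).color I = Nat.card X ↔ I = ⊤ :=
  (Set.eq_univ_iff_ncard _).symm.trans LowerSet.coe_eq_univ

theorem subsingleton_reducedHomology_rankSelected (𝕜 : Type*) [Field 𝕜] {S : Finset ℕ}
    (hS : S ⊆ Finset.Icc 1 (Nat.card X - 1)) {n : ℕ} (hn : n ≠ S.card) :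
    Subsingleton (ReducedHomology 𝕜 ((rankColoring X).select S) n) := by
  refine subsingleton_reducedHomology 𝕜 _ ?_
  rcases hn.lt_or_gt with hlt | hgt
  · exact rankSelected_cycleSpace_le_boundarySpace 𝕜 hS hlt
  · rw [cycleSpace, chainSpace_eq_bot 𝕜 fun σ hσ =>
      ((card_le_of_mem_colorSelect _ S hσ).trans_lt hgt).ne, bot_inf_eq]
    exact bot_le

variable {G : Type*} [Group G] (a : G →* (X ≃o X))

theorem flagHChar_eq_zero {S : Finset ℕ} (hS : S ⊆ Finset.range (Nat.card X + 1))
    (hS' : ¬ S ⊆ Finset.Icc 1 (Nat.card X - 1)) :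
    flagHChar (idealAction a) (rankColoring X) (idealAction_preserves a) S = 0 := by
  classical
  obtain ⟨s, hs, hs'⟩ := Finset.not_subset.1 hS'
  have hrange := Finset.mem_range_succ_iff.1 (hS hs)
  rw [Finset.mem_Icc] at hs'
  obtain rfl | rfl : s = 0 ∨ s = Nat.card X := by omega
  · refine flagHChar_eq_zero_of_cone _ _ _ (v := ⊥) (fun I hI => ?_)
      (fun σ hσ => insert_mem_orderComplex hσ fun _ _ => Or.inl bot_le)
      (rankColoring_bot (X := X) ▸ hs)
    exact rankColoring_eq_zero_iff.1 (hI.trans rankColoring_bot)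
  · refine flagHChar_eq_zero_of_cone _ _ _ (v := ⊤) (fun I hI => ?_)
      (fun σ hσ => insert_mem_orderComplex hσ fun _ _ => Or.inr le_top)
      (rankColoring_top (X := X) ▸ hs)
    exact rankColoring_eq_card_iff.1 (hI.trans rankColoring_top)

theorem flagHChar_eq_homologyRep_character {S : Finset ℕ}
    (hS : S ⊆ Finset.Icc 1 (Nat.card X - 1)) :
    flagHChar (idealAction a) (rankColoring X) (idealAction_preserves a) S =
      (homologyRep ℂ ((rankColoring X).select S)
        ((idealAction a).select (rankColoring X) (idealAction_preserves a) S)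
        (idealAction_preserves a) S.card).character :=
  (flagHChar_eq_sum_fChar_select _ _ _ S).trans (homologyRep_character _ _ _
    (fun _ hn => rankSelected_cycleSpace_le_boundarySpace ℂ hS hn)
    (fun _ hσ => card_le_of_mem_colorSelect _ S hσ)).symm

theorem isEffective_flagHChar {S : Finset ℕ} (hS : S ⊆ Finset.range (Nat.card X + 1)) :
    IsEffective (flagHChar (idealAction a) (rankColoring X) (idealAction_preserves a) S) := by
  by_cases hS' : S ⊆ Finset.Icc 1 (Nat.card X - 1)
  · rw [flagHChar_eq_homologyRep_character a hS']
    have : FiniteDimensional ℂ (ReducedHomology ℂ ((rankColoring X).select S) S.card) :=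
      finiteDimensional_subQuotient _ _
    exact isEffective_of_representation _
  · rw [flagHChar_eq_zero a hS hS']
    exact isEffective_zero

theorem Icc_one_sub_one_subset_range (d : ℕ) : Finset.Icc 1 (d - 1) ⊆ Finset.range (d + 1) := by
  intro s hs
  simp only [Finset.mem_Icc, Finset.mem_range] at hs ⊢
  omega

theorem hChar_idealAction_eq_sum_range (i : ℕ) :
    hChar (idealAction a) i = ∑ S ∈ (Finset.range (Nat.card X + 1)).powersetCard i,
      flagHChar (idealAction a) (rankColoring X) (idealAction_preserves a) S :=
  hChar_eq_sum_flagHChar _ _ _ (fun _ _ I _ => rankColoring_mem_range I)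
    ((maxFaceCard_orderComplex X).trans (Finset.card_range _).symm) i

theorem hChar_idealAction_eq_sum_Icc (i : ℕ) :
    hChar (idealAction a) i = ∑ S ∈ (Finset.Icc 1 (Nat.card X - 1)).powersetCard i,
      flagHChar (idealAction a) (rankColoring X) (idealAction_preserves a) S := by
  rw [hChar_idealAction_eq_sum_range]
  refine (Finset.sum_subset (Finset.powersetCard_mono (Icc_one_sub_one_subset_range _))
    fun S hS hS' => ?_).symm
  rw [Finset.mem_powersetCard] at hS hS'
  exact flagHChar_eq_zero a hS.1 fun h => hS' ⟨h, hS.2⟩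

theorem isEffective_hChar_idealAction (k : ℕ) : IsEffective (hChar (idealAction a) k) := by
  rw [hChar_idealAction_eq_sum_range]
  exact isEffective_sum fun S hS => isEffective_flagHChar a (Finset.mem_powersetCard.1 hS).1

theorem eqHilb_idealAction :
    eqHilb ℂ (idealAction a) = ↑(PowerSeries.invOneSubPow (G → ℂ) (Nat.card X + 1)) *
      ∑ S ∈ (Finset.Icc 1 (Nat.card X - 1)).powerset,
        PowerSeries.C (flagHChar (idealAction a) (rankColoring X) (idealAction_preserves a) S) *
          PowerSeries.X ^ S.card := by
  rw [eqHilb_eq_invOneSubPow_mul_sum (idealAction a) (rankColoring X) (idealAction_preserves a)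
    (fun _ _ I _ => rankColoring_mem_range I), Finset.card_range]
  congr 1
  refine (Finset.sum_subset (Finset.powerset_mono.2 (Icc_one_sub_one_subset_range _))
    fun S hS hS' => ?_).symm
  rw [Finset.mem_powerset] at hS hS'
  rw [flagHChar_eq_zero a hS hS', map_zero, zero_mul]

end OrderIdeals

theorem theorem6p4_general {X G : Type*} [PartialOrder X] [Finite X] [Group G]
    (a : G →* (X ≃o X)) :
    (∃ hP : ∀ g, coordRep a g '' orderPolytope X = orderPolytope X,
      eqEhr (coordRep a) (intLattice X) (coordRep_intLattice a) (orderPolytope X) hP =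
        eqHilb ℂ (idealAction a) ∧
      eqEhr (coordRep a) (intLattice X) (coordRep_intLattice a) (orderPolytope X) hP =
        ↑(PowerSeries.invOneSubPow (G → ℂ) (Nat.card X + 1)) *
          ∑ S ∈ (Finset.Icc 1 (Nat.card X - 1)).powerset,
            PowerSeries.C (flagHChar (idealAction a) (rankColoring X)
              (idealAction_preserves a) S) * PowerSeries.X ^ S.card) ∧
    (∀ S ⊆ Finset.Icc 1 (Nat.card X - 1),
      (∀ n, n ≠ S.card → Subsingleton (ReducedHomology ℂ ((rankColoring X).select S) n)) ∧
      flagHChar (idealAction a) (rankColoring X) (idealAction_preserves a) S =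
        (homologyRep ℂ ((rankColoring X).select S)
          ((idealAction a).select (rankColoring X) (idealAction_preserves a) S)
          (idealAction_preserves a) S.card).character) ∧
    (∀ k, IsEffective (hChar (idealAction a) k)) ∧
    (∀ S ⊆ Finset.range (Nat.card X + 1),
      IsEffective (flagHChar (idealAction a) (rankColoring X) (idealAction_preserves a) S)) ∧
    (∀ i, hChar (idealAction a) i =
      ∑ S ∈ (Finset.range (Nat.card X + 1)).powersetCard i,
        flagHChar (idealAction a) (rankColoring X) (idealAction_preserves a) S) ∧
    (∀ i, hChar (idealAction a) i =
      ∑ S ∈ (Finset.Icc 1 (Nat.card X - 1)).powersetCard i,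
        flagHChar (idealAction a) (rankColoring X) (idealAction_preserves a) S) := by
  have hEhr := eqEhr_eq_eqHilb a (coordRep_image_orderPolytope a)
  exact ⟨⟨coordRep_image_orderPolytope a, hEhr, hEhr.trans (eqHilb_idealAction a)⟩,
    fun S hS => ⟨fun n hn => subsingleton_reducedHomology_rankSelected ℂ hS hn,
      flagHChar_eq_homologyRep_character a hS⟩,
    isEffective_hChar_idealAction a, fun S hS => isEffective_flagHChar a hS,
    hChar_idealAction_eq_sum_range a, hChar_idealAction_eq_sum_Icc a⟩

theorem theorem6p4 {X G : Type*} [PartialOrder X] [Finite X] [Group G] [Finite G]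
    (a : G →* (X ≃o X)) :
    -- the order polytope is invariant, and the two expressions of its equivariant Ehrhart series
    (∃ hP : ∀ g, coordRep a g '' orderPolytope X = orderPolytope X,
      eqEhr (coordRep a) (intLattice X) (coordRep_intLattice a) (orderPolytope X) hP =
        eqHilb ℂ (idealAction a) ∧
      eqEhr (coordRep a) (intLattice X) (coordRep_intLattice a) (orderPolytope X) hP =
        ↑(PowerSeries.invOneSubPow (G → ℂ) (Nat.card X + 1)) *
          ∑ S ∈ (Finset.Icc 1 (Nat.card X - 1)).powerset,
            PowerSeries.C (flagHChar (idealAction a) (rankColoring X)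
              (idealAction_preserves a) S) * PowerSeries.X ^ S.card) ∧
    -- the reduced homology of a rank-selected complex sits in the top degree `|S| - 1`, where it
    -- affords the flag `h`-entry
    (∀ S ⊆ Finset.Icc 1 (Nat.card X - 1),
      (∀ n, n ≠ S.card → Subsingleton (ReducedHomology ℂ ((rankColoring X).select S) n)) ∧
      flagHChar (idealAction a) (rankColoring X) (idealAction_preserves a) S =
        (homologyRep ℂ ((rankColoring X).select S)
          ((idealAction a).select (rankColoring X) (idealAction_preserves a) S)
          (idealAction_preserves a) S.card).character) ∧
    -- all entries are effective
    (∀ k, IsEffective (hChar (idealAction a) k)) ∧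
    (∀ S ⊆ Finset.range (Nat.card X + 1),
      IsEffective (flagHChar (idealAction a) (rankColoring X) (idealAction_preserves a) S)) ∧
    -- the flag `h`-vector refines the `h`-vector
    (∀ i, hChar (idealAction a) i =
      ∑ S ∈ (Finset.range (Nat.card X + 1)).powersetCard i,
        flagHChar (idealAction a) (rankColoring X) (idealAction_preserves a) S) ∧
    (∀ i, hChar (idealAction a) i =
      ∑ S ∈ (Finset.Icc 1 (Nat.card X - 1)).powersetCard i,
        flagHChar (idealAction a) (rankColoring X) (idealAction_preserves a) S) :=
  theorem6p4_general a
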